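/- Let $(\Omega,\mu)$ be a probability space. For a measurable function $Z$ on $\Omega$ and $p\ge 1$ put $\|Z\|_{(p)}=\sup_{1\le r\le p}\|Z\|_{L_r(\mu)}/\sqrt r$ ($r$ real). For a class $F$ of measurable functions $f:\Omega\to\mathbb R$, an admissible sequence of $F$ is a sequence of subsets $F_s\subset F$, $s\ge 0$, with $|F_0|=1$ and $|F_s|\le 2^{2^s}$ for $s\ge 1$. For $u\geq 1$ and an integer $s_0\ge 0$ set $$\tilde\Lambda_{s_0,u}(F)=\inf\Big(\sup_{f\in F}\sum_{s\ge s_0}2^{s/2}\|f-\pi_sf\|_{(u^22^s)}+2^{s_0/2}\sup_{f\in F}\|\pi_{s_0}f\|_{(u^22^{s_0})}\Big),$$ where the infimum is over all admissible sequences $(F_s)_{s\ge0}$ of $F$ and all maps $\pi_s:F\to F_s$ for which $\pi_sf$ is a nearest point to $f$ in $F_s$ with respect to $\|\cdot\|_{(u^22^s)}$. Let $d_q(F)=\sup_{f\in F}\|f\|_{L_q(\mu)}$. All these quantities take values in $[0,\infty]$, with $0\cdot\infty=0$ and $\inf\emptyset=\infty$. Call $F$ separable if there are a countable $F'\subset F$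 and a $\mu$-null set outside of which every $f\in F$ is the pointwise limit of a sequence in $F'$ (every countable class is separable). **Theorem.** There is an absolute constant $c_0>0$, and for every $q>4$ there is a constant $c_1(q)>0$ depending only on $q$, such that the following holds. Let $F$ and $H$ be separable classes of measurable real-valued functions on a probability space $(\Omega,\mu)$, let $X_1,\dots,X_N$ be independent random variables distributed according to $\mu$, let $u\ge\max\{8,\sqrt q\}$ and let $s_0\ge0$ be an integer. Then, with probability at least $1-2\exp(-c_0u^22^{s_0})$, for every $f\in F$ and $h\in H$, $$\Big|\sum_{i=1}^N\big(f(X_i)h(X_i)-\mathbb E fh\big)\Big|\le c_1(q)\Big(u^2\tilde\Lambda_{s_0,u}(H)\tilde\Lambda_{s_0,u}(F)+u\sqrt N\big(d_q(F)\tilde\Lambda_{s_0,u}(H)+d_q(H)\tilde\Lambda_{s_0,u}(F)\big)\Big),$$ where nothing is claimed if the right-hand side is infinite (when it is finite, every product $fh$ is integrable). In particular, for $F=H$, with probability at least $1-2\exp(-c_0u^22^{s_0})$, for every $f\in F$, $$\Big|\sum_{i=1}^N\big(f^2(X_i)-\mathbb E f^2\big)\Big|\le c_1(q)\Big(u^2\tilde\Lambda_{s_0,u}^2(F)+u\sqrt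 N\,d_q(F)\tilde\Lambda_{s_0,u}(F)\Big).$$ Here "with probability at least $a$" means that there is a measurable event of probability at least $a$ on which the inequality holds for all functions simultaneously. -/

import Mathlib

open MeasureTheory ProbabilityTheory
open scoped ENNReal

namespace ProductProcess

/-- An admissible sequence of a class `F`: subsets `A s ⊆ F` with `|A 0| = 1` and
`|A s| ≤ 2 ^ (2 ^ s)` for `s ≥ 1`. -/
structure IsAdmissible {Ω : Type*} (F : Set (Ω → ℝ)) (A : ℕ → Set (Ω → ℝ)) : Prop where
  subset : ∀ s, A s ⊆ F
  card_zero : (A 0).encard = 1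
  card_le : ∀ s, 1 ≤ s → (A s).encard ≤ 2 ^ (2 ^ s)

/-- The graded norm `‖Z‖_(p) = sup_{1 ≤ r ≤ p} ‖Z‖_{L_r} / √r` (`r` real), with values in
`[0, ∞]`. -/
noncomputable def gradedNorm {Ω : Type*} [MeasurableSpace Ω] (μ : Measure Ω) (p : ℝ)
    (Z : Ω → ℝ) : ℝ≥0∞ :=
  ⨆ r ∈ Set.Icc (1 : ℝ) p, eLpNorm Z (ENNReal.ofReal r) μ / ENNReal.ofReal (√r)

/-- `g` is a nearest point to `f` in `S` with respect to the norm `‖·‖_(p)`. -/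
def IsNearestPoint {Ω : Type*} [MeasurableSpace Ω] (μ : Measure Ω) (p : ℝ)
    (S : Set (Ω → ℝ)) (f g : Ω → ℝ) : Prop :=
  g ∈ S ∧ ∀ g' ∈ S, gradedNorm μ p (f - g) ≤ gradedNorm μ p (f - g')

/-- `π s f` is, for every `s` and `f ∈ F`, a nearest point to `f` in `A s` with respect to the
norm `‖·‖_(u² 2^s)`. -/
def IsNearestPointMap {Ω : Type*} [MeasurableSpace Ω] (μ : Measure Ω) (u : ℝ)
    (F : Set (Ω → ℝ)) (A : ℕ → Set (Ω → ℝ)) (π : ℕ → (Ω → ℝ) → (Ω → ℝ)) : Prop :=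
  ∀ s, ∀ f ∈ F, IsNearestPoint μ (u ^ 2 * 2 ^ s) (A s) f (π s f)

/-- The chaining sum `sup_{f ∈ F} ∑_{s ≥ s₀} 2^{s/2} ‖f - π_s f‖_(u² 2^s)`. -/
noncomputable def chainSum {Ω : Type*} [MeasurableSpace Ω] (μ : Measure Ω) (s₀ : ℕ) (u : ℝ)
    (F : Set (Ω → ℝ)) (π : ℕ → (Ω → ℝ) → (Ω → ℝ)) : ℝ≥0∞ :=
  ⨆ f ∈ F, ∑' s : Set.Ici s₀,
    (2 : ℝ≥0∞) ^ (((s : ℕ) : ℝ) / 2) * gradedNorm μ (u ^ 2 * 2 ^ (s : ℕ)) (f - π s f)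

/-- The contribution of the starting points of the chains,
`2^{s₀/2} sup_{f ∈ F} ‖π_{s₀} f‖_(u² 2^{s₀})`. -/
noncomputable def chainStart {Ω : Type*} [MeasurableSpace Ω] (μ : Measure Ω) (s₀ : ℕ) (u : ℝ)
    (F : Set (Ω → ℝ)) (π : ℕ → (Ω → ℝ) → (Ω → ℝ)) : ℝ≥0∞ :=
  (2 : ℝ≥0∞) ^ ((s₀ : ℝ) / 2) * ⨆ f ∈ F, gradedNorm μ (u ^ 2 * 2 ^ s₀) (π s₀ f)

/-- The complexity parameter `Λ̃_{s₀,u}(F)`: the infimum, over all admissible sequences of `F`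
and nearest point maps `π_s : F → F_s`, of
`sup_{f ∈ F} ∑_{s ≥ s₀} 2^{s/2} ‖f - π_s f‖_(u² 2^s) + 2^{s₀/2} sup_{f ∈ F} ‖π_{s₀} f‖_(u² 2^{s₀})`;
both terms are computed along the same admissible sequence. -/
noncomputable def LambdaTilde {Ω : Type*} [MeasurableSpace Ω] (μ : Measure Ω) (s₀ : ℕ) (u : ℝ)
    (F : Set (Ω → ℝ)) : ℝ≥0∞ :=
  ⨅ (A : ℕ → Set (Ω → ℝ)) (π : ℕ → (Ω → ℝ) → (Ω → ℝ))
    (_ : IsAdmissible F A ∧ IsNearestPointMap μ u F A π),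
    chainSum μ s₀ u F π + chainStart μ s₀ u F π

/-- `d_q(F) = sup_{f ∈ F} ‖f‖_{L_q}`, with values in `[0, ∞]`. -/
noncomputable def radius {Ω : Type*} [MeasurableSpace Ω] (μ : Measure Ω) (q : ℝ)
    (F : Set (Ω → ℝ)) : ℝ≥0∞ :=
  ⨆ f ∈ F, eLpNorm f (ENNReal.ofReal q) μ

/-- The usual separability of a class of functions: outside one `μ`-null set, every `f ∈ F` is the
pointwise limit of a sequence taken from a fixed countable subset of `F`. Every countable class
has this property. -/
def IsSeparableClass {Ω : Type*} [MeasurableSpace Ω] (μ : Measure Ω) (F : Set (Ω → ℝ)) : Prop :=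
  ∃ F₀ ⊆ F, F₀.Countable ∧ ∃ S : Set Ω, μ S = 0 ∧
    ∀ f ∈ F, ∃ g : ℕ → Ω → ℝ, (∀ n, g n ∈ F₀) ∧
      ∀ x ∉ S, Filter.Tendsto (fun n => g n x) Filter.atTop (nhds (f x))

end ProductProcess

namespace ProductProcess

/-! ### Graded norms and the moments they control -/

section Moments

variable {Ω : Type*} [MeasurableSpace Ω] {μ : Measure Ω}

/-! The proof chains both classes at once, and its one probabilistic ingredient is a deviation bound
for a single product. For fixed `U` and `V`, with `p ≥ 64`, `A` bounding the graded norm of `U` at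
level `p`, and `‖V‖_{L₄} ≤ b`, the centred sum of `U V` exceeds a constant times `√p A (‖V‖_emp + √N
b)` with probability at most `3 exp(-2p)`, where `‖V‖_emp = √(∑ V(Xᵢ)²)`
(`measure_lt_abs_sum_mul_sub_le`). The sample is split by a rare set `B` on which `U` or `V` is
large. Off `B` the product is bounded and a Bennett-type inequality applies. On `B`, Cauchy-Schwarz
leaves `‖V‖_emp` and the sum of `U²` over `B`, which `measure_sum_indicator_sq_ge_le` bounds by a
constant times `p A²`. Since `U` has controlled moments only up to order `p`, that lemma replaces
the exponential by its Taylor polynomial, which is still submultiplicative on nonnegative reals.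

With `p = u² 2^s`, the factor `exp(-2p)` beats the number of triples of points at levels `s` and `s
+ 1`, so all links hold simultaneously (`measure_not_linksHold_le`). Telescoping then bounds the
deviation of the product of two chains by their complexities times the empirical norms of the chain
points (`abs_prodDev_chain_le`). These norms are random, but applying the same estimate to the
square of the largest chain point gives a quadratic inequality for its norm, hence a deterministic
bound (`sqrt_sum_sq_chain_le`), which is fed back in.

The bound passes from chain points to all functions by a limit along the chains for a countable
dense subclass, and then by separability. Expectations converge because the products are bounded in
`L₂`. The parameter `q` enters only through `4 < q ≤ u²`: only `L₄` norms are used, and they are at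
most `d_q`. The constants obtained do not depend on `q`. -/

theorem integrable_pow_and_integral_le {U : Ω → ℝ} (hU : Measurable U) {k : ℕ} (hk : k ≠ 0)
    {b : ℝ} (hb : 0 ≤ b) (h : eLpNorm U (k : ℝ≥0∞) μ ≤ ENNReal.ofReal b) :
    Integrable (fun x => |U x| ^ k) μ ∧ ∫ x, |U x| ^ k ∂μ ≤ b ^ k := by
  have hmem : MemLp U (k : ℝ≥0∞) μ :=
    ⟨hU.aestronglyMeasurable, h.trans_lt ENNReal.ofReal_lt_top⟩
  have hint := hmem.integrable_norm_pow hk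
  simp only [Real.norm_eq_abs] at hint
  refine ⟨hint, ?_⟩
  have hk' : (k : NNReal) ≠ 0 := by exact_mod_cast hk
  have h1 := eLpNorm_nnreal_pow_eq_lintegral (f := U) (μ := μ) hk'
  simp only [ENNReal.coe_natCast, NNReal.coe_natCast, ENNReal.rpow_natCast] at h1
  rw [integral_eq_lintegral_of_nonneg_ae (ae_of_all _ fun x => by positivity)
    hint.aestronglyMeasurable]
  refine ENNReal.toReal_le_of_le_ofReal (by positivity) ?_
  have h2 : ∫⁻ x, ENNReal.ofReal (|U x| ^ k) ∂μ = eLpNorm U (k : ℝ≥0∞) μ ^ k := by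
    rw [h1]
    refine lintegral_congr fun x => ?_
    rw [ENNReal.ofReal_pow (abs_nonneg _), Real.enorm_eq_ofReal_abs]
  rw [h2, ENNReal.ofReal_pow hb]
  gcongr

theorem eLpNorm_le_gradedNorm (U : Ω → ℝ) {p r : ℝ} (hr : 1 ≤ r) (hrp : r ≤ p) :
    eLpNorm U (ENNReal.ofReal r) μ ≤ gradedNorm μ p U * ENNReal.ofReal (√r) := by
  have h0 : ENNReal.ofReal (√r) ≠ 0 := by
    simp only [ne_eq, ENNReal.ofReal_eq_zero, not_le]
    exact Real.sqrt_pos.2 (by linarith)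
  rw [← ENNReal.div_le_iff h0 ENNReal.ofReal_ne_top]
  exact le_iSup₂ (f := fun r (_ : r ∈ Set.Icc (1 : ℝ) p) =>
    eLpNorm U (ENNReal.ofReal r) μ / ENNReal.ofReal (√r)) r ⟨hr, hrp⟩

theorem integrable_pow_and_integral_le_of_gradedNorm {U : Ω → ℝ} (hU : Measurable U)
    {p A : ℝ} (hA : 0 ≤ A) (h : gradedNorm μ p U ≤ ENNReal.ofReal A)
    {k : ℕ} (hk : 1 ≤ k) (hkp : (k : ℝ) ≤ p) :
    Integrable (fun x => |U x| ^ k) μ ∧ ∫ x, |U x| ^ k ∂μ ≤ (A * √k) ^ k := by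
  refine integrable_pow_and_integral_le hU (by omega) (by positivity) ?_
  have h1 := eLpNorm_le_gradedNorm (μ := μ) U (r := k) (p := p) (by exact_mod_cast hk) hkp
  rw [ENNReal.ofReal_natCast] at h1
  rw [ENNReal.ofReal_mul hA]
  exact h1.trans (by gcongr)

theorem gradedNorm_mono (U : Ω → ℝ) {p p' : ℝ} (h : p ≤ p') :
    gradedNorm μ p U ≤ gradedNorm μ p' U :=
  iSup₂_le fun r hr => le_iSup₂ (f := fun r (_ : r ∈ Set.Icc (1 : ℝ) p') =>
    eLpNorm U (ENNReal.ofReal r) μ / ENNReal.ofReal (√r)) r ⟨hr.1, hr.2.trans h⟩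

theorem gradedNorm_neg (p : ℝ) (U : Ω → ℝ) : gradedNorm μ p (-U) = gradedNorm μ p U := by
  simp only [gradedNorm, eLpNorm_neg]

theorem gradedNorm_add_le {U V : Ω → ℝ} (hU : Measurable U) (hV : Measurable V) (p : ℝ) :
    gradedNorm μ p (U + V) ≤ gradedNorm μ p U + gradedNorm μ p V := by
  refine iSup₂_le fun r hr => ?_
  have h1 : eLpNorm (U + V) (ENNReal.ofReal r) μ ≤
      eLpNorm U (ENNReal.ofReal r) μ + eLpNorm V (ENNReal.ofReal r) μ :=
    eLpNorm_add_le hU.aestronglyMeasurable hV.aestronglyMeasurable (by simpa using hr.1)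
  refine (ENNReal.div_le_div_right h1 _).trans ?_
  rw [ENNReal.add_div]
  exact add_le_add
    (le_iSup₂ (f := fun r (_ : r ∈ Set.Icc (1 : ℝ) p) =>
      eLpNorm U (ENNReal.ofReal r) μ / ENNReal.ofReal (√r)) r hr)
    (le_iSup₂ (f := fun r (_ : r ∈ Set.Icc (1 : ℝ) p) =>
      eLpNorm V (ENNReal.ofReal r) μ / ENNReal.ofReal (√r)) r hr)

theorem gradedNorm_sub_le {U V W : Ω → ℝ} (hU : Measurable U) (hV : Measurable V)
    (hW : Measurable W) (p : ℝ) :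
    gradedNorm μ p (V - U) ≤ gradedNorm μ p (W - U) + gradedNorm μ p (W - V) := by
  have h := gradedNorm_add_le (μ := μ) (hW.sub hU) (hW.sub hV).neg p
  rwa [gradedNorm_neg, show W - U + -(W - V) = V - U by ring] at h

end Moments

/-! ### Laplace transforms, Bennett's inequality and the truncated exponential -/

section Sampling

variable {Ω : Type*} [MeasurableSpace Ω] {μ : Measure Ω}
  {Ω' : Type*} [MeasurableSpace Ω'] {P : Measure Ω'} {N : ℕ} {X : Fin N → Ω' → Ω}

theorem measure_exp_le_prod_le (hX : ∀ i, MeasurePreserving (X i) P μ) (hind : iIndepFun X P)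
    {g : Ω → ℝ} (hg : Measurable g) (hg0 : ∀ x, 0 ≤ g x) {c : ℝ}
    (hc : ∫⁻ x, ENNReal.ofReal (g x) ∂μ ≤ ENNReal.ofReal (Real.exp c)) (t : ℝ) :
    P {ω | Real.exp t ≤ ∏ i, g (X i ω)} ≤ ENNReal.ofReal (Real.exp (N * c - t)) := by
  have hm : ∀ i, Measurable fun ω => ENNReal.ofReal (g (X i ω)) := fun i =>
    (hg.comp (hX i).measurable).ennreal_ofReal
  have h1 : ∫⁻ ω, ∏ i, ENNReal.ofReal (g (X i ω)) ∂P ≤ ENNReal.ofReal (Real.exp c) ^ N := by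
    rw [lintegral_prod_eq_prod_lintegral_of_indepFun Finset.univ
      (fun i ω => ENNReal.ofReal (g (X i ω)))
      (hind.comp (fun _ x => ENNReal.ofReal (g x)) fun _ => hg.ennreal_ofReal) hm]
    calc ∏ i, ∫⁻ ω, ENNReal.ofReal (g (X i ω)) ∂P
        = ∏ _i : Fin N, ∫⁻ x, ENNReal.ofReal (g x) ∂μ :=
          Finset.prod_congr rfl fun i _ => (hX i).lintegral_comp hg.ennreal_ofReal
      _ = (∫⁻ x, ENNReal.ofReal (g x) ∂μ) ^ N := by simp
      _ ≤ _ := by gcongr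
  have hset : {ω | Real.exp t ≤ ∏ i, g (X i ω)} =
      {ω | ENNReal.ofReal (Real.exp t) ≤ ∏ i, ENNReal.ofReal (g (X i ω))} := by
    ext ω
    simp only [Set.mem_ofPred_eq]
    rw [← ENNReal.ofReal_prod_of_nonneg fun i _ => hg0 _, ENNReal.ofReal_le_ofReal_iff
      (Finset.prod_nonneg fun i _ => hg0 _)]
  have hpos : ENNReal.ofReal (Real.exp t) ≠ 0 := by simp [Real.exp_pos]
  rw [hset]
  refine (meas_ge_le_lintegral_div (Finset.measurable_prod _ fun i _ => hm i).aemeasurable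
    hpos ENNReal.ofReal_ne_top).trans ?_
  refine (ENNReal.div_le_div_right h1 _).trans (le_of_eq ?_)
  rw [← ENNReal.ofReal_pow (Real.exp_pos _).le, ← ENNReal.ofReal_div_of_pos (Real.exp_pos _),
    Real.exp_sub, Real.exp_nat_mul]

/-- Bennett-type deviation inequality for bounded variables. -/
theorem measure_sum_sub_integral_ge_le [IsProbabilityMeasure μ]
    (hX : ∀ i, MeasurePreserving (X i) P μ)
    (hind : iIndepFun X P) {W : Ω → ℝ} (hW : Measurable W) {M v : ℝ} (hM : 0 < M)
    (hWM : ∀ x, |W x| ≤ M) (hv : ∫ x, W x ^ 2 ∂μ ≤ v * M ^ 2) (t : ℝ) :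
    P {ω | t * M ≤ ∑ i, (W (X i ω) - ∫ x, W x ∂μ)} ≤
      ENNReal.ofReal (Real.exp (N * v - t)) := by
  have hWint : Integrable W μ := Integrable.of_bound hW.aestronglyMeasurable M
    (ae_of_all _ fun x => by simpa using hWM x)
  have hW2int : Integrable (fun x => W x ^ 2) μ :=
    Integrable.of_bound (hW.pow_const 2).aestronglyMeasurable (M ^ 2)
      (ae_of_all _ fun x => by
        rw [Real.norm_eq_abs, abs_pow]
        exact pow_le_pow_left₀ (abs_nonneg _) (hWM x) 2)
  set m := ∫ x, W x ∂μ with hm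
  -- The estimate `exp t ≤ 1 + t + t²`, valid for `|t| ≤ 1`; it makes the Laplace transform depend
  -- on the mean and second moment only.
  have hpt : ∀ x, Real.exp (W x / M) ≤ 1 + W x / M + W x ^ 2 / M ^ 2 := fun x => by
    have h1 : |W x / M| ≤ 1 := by
      rw [abs_div, abs_of_pos hM]
      exact (div_le_one hM).2 (hWM x)
    have h2 := (abs_le.1 (Real.abs_exp_sub_one_sub_id_le h1)).2
    rw [div_pow] at h2
    linarith
  have hc : ∫⁻ x, ENNReal.ofReal (Real.exp (W x / M)) ∂μ ≤
      ENNReal.ofReal (Real.exp (m / M + v)) := by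
    have hi : Integrable (fun x => 1 + W x / M + W x ^ 2 / M ^ 2) μ :=
      ((integrable_const _).add (hWint.div_const _)).add (hW2int.div_const _)
    calc ∫⁻ x, ENNReal.ofReal (Real.exp (W x / M)) ∂μ
        ≤ ∫⁻ x, ENNReal.ofReal (1 + W x / M + W x ^ 2 / M ^ 2) ∂μ :=
          lintegral_mono fun x => ENNReal.ofReal_le_ofReal (hpt x)
      _ = ENNReal.ofReal (∫ x, (1 + W x / M + W x ^ 2 / M ^ 2) ∂μ) :=
          (ofReal_integral_eq_lintegral_ofReal hi
            (ae_of_all _ fun x => (Real.exp_pos _).le.trans (hpt x))).symm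
      _ ≤ _ := by
          refine ENNReal.ofReal_le_ofReal ?_
          have e1 : ∫ x, (1 + W x / M + W x ^ 2 / M ^ 2) ∂μ =
              1 + m / M + (∫ x, W x ^ 2 ∂μ) / M ^ 2 := by
            have i1 : Integrable (fun x => 1 + W x / M) μ :=
              (integrable_const _).add (hWint.div_const _)
            rw [integral_add i1 (hW2int.div_const _), integral_add (integrable_const _)
              (hWint.div_const _), integral_div, integral_div]
            simp [hm]
          have e2 : (∫ x, W x ^ 2 ∂μ) / M ^ 2 ≤ v := (div_le_iff₀ (by positivity)).2 hv
          have e3 := Real.add_one_le_exp (m / M + v)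
          rw [e1]
          linarith
  have h := measure_exp_le_prod_le hX hind (g := fun x => Real.exp (W x / M))
    (hW.div_const M).exp (fun x => (Real.exp_pos _).le) hc (t + N * (m / M))
  have e : N * (m / M + v) - (t + N * (m / M)) = N * v - t := by ring
  rw [e] at h
  refine le_trans (measure_mono fun ω hω => ?_) h
  simp only [Set.mem_ofPred_eq] at hω ⊢
  rw [← Real.exp_sum, Real.exp_le_exp, ← Finset.sum_div, le_div_iff₀ hM]
  rw [Finset.sum_sub_distrib] at hω
  simp only [Finset.sum_const, Finset.card_univ, Fintype.card_fin, nsmul_eq_mul] at hω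
  have : (t + N * (m / M)) * M = t * M + N * m := by field_simp
  linarith

/-- The truncated exponential series. -/
noncomputable def truncExp (n : ℕ) (t : ℝ) : ℝ := ∑ j ∈ Finset.range (n + 1), t ^ j / j.factorial

theorem truncExp_nonneg (n : ℕ) {t : ℝ} (ht : 0 ≤ t) : 0 ≤ truncExp n t :=
  Finset.sum_nonneg fun j _ => by positivity

theorem truncExp_zero (n : ℕ) : truncExp n 0 = 1 := by
  rw [truncExp, Finset.sum_range_succ']
  simp

/-- The binomial theorem turns the left side into the part `k + l ≤ n` of the double sum on the
right, and the omitted terms are nonnegative. This substitutes for `exp (s + t) = exp s * exp t`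
when only finitely many moments exist. -/
theorem truncExp_add_le (n : ℕ) {s t : ℝ} (hs : 0 ≤ s) (ht : 0 ≤ t) :
    truncExp n (s + t) ≤ truncExp n s * truncExp n t := by
  have h1 : truncExp n (s + t) = ∑ j ∈ Finset.range (n + 1), ∑ k ∈ Finset.range (j + 1),
      s ^ k / k.factorial * (t ^ (j - k) / (j - k).factorial) := by
    refine Finset.sum_congr rfl fun j _ => ?_
    rw [add_pow, Finset.sum_div]
    refine Finset.sum_congr rfl fun k hk => ?_
    have h2 := Nat.choose_mul_factorial_mul_factorial (Nat.lt_succ_iff.1 (Finset.mem_range.1 hk))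
    have h3 : (j.choose k : ℝ) * k.factorial * (j - k).factorial = j.factorial := by
      exact_mod_cast h2
    rw [← h3]
    have h4 : (j.choose k : ℝ) ≠ 0 := by
      exact_mod_cast (Nat.choose_pos (Nat.lt_succ_iff.1 (Finset.mem_range.1 hk))).ne'
    field_simp
  rw [h1, Finset.sum_range_diag_flip (n + 1)
    fun k l => s ^ k / (k.factorial : ℝ) * (t ^ l / (l.factorial : ℝ)),
    truncExp, truncExp, Finset.sum_mul_sum]
  refine Finset.sum_le_sum fun k _ => ?_
  exact Finset.sum_le_sum_of_subset_of_nonneg (Finset.range_mono (Nat.sub_le _ _))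
    fun l _ _ => by positivity

theorem truncExp_sum_le (n : ℕ) {ι : Type*} (s : Finset ι) {t : ι → ℝ} (ht : ∀ i, 0 ≤ t i) :
    truncExp n (∑ i ∈ s, t i) ≤ ∏ i ∈ s, truncExp n (t i) := by
  classical
  induction s using Finset.induction_on with
  | empty => simp [truncExp_zero]
  | insert a s ha ih =>
    rw [Finset.sum_insert ha, Finset.prod_insert ha]
    exact (truncExp_add_le n (ht a) (Finset.sum_nonneg fun i _ => ht i)).trans
      (mul_le_mul_of_nonneg_left ih (truncExp_nonneg n (ht a)))

/-- The top term alone suffices: `w ^ n / n! ≥ (w / n) ^ n`. -/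
theorem exp_mul_le_truncExp {n : ℕ} (hn : n ≠ 0) {a w : ℝ} (hw : n * Real.exp a ≤ w) :
    Real.exp (a * n) ≤ truncExp n w := by
  have hn' : (0 : ℝ) < n := by positivity
  have hw0 : 0 ≤ w := le_trans (by positivity) hw
  have h1 : w ^ n / n.factorial ≤ truncExp n w :=
    Finset.single_le_sum (f := fun j => w ^ j / (j.factorial : ℝ)) (fun j _ => by positivity)
      (Finset.self_mem_range_succ n)
  refine le_trans ?_ h1
  rw [le_div_iff₀ (by positivity), mul_comm a, Real.exp_nat_mul]
  have h2 : (n.factorial : ℝ) ≤ (n : ℝ) ^ n := by exact_mod_cast Nat.factorial_le_pow n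
  calc Real.exp a ^ n * n.factorial ≤ Real.exp a ^ n * (n : ℝ) ^ n := by gcongr
    _ = (n * Real.exp a) ^ n := by rw [mul_pow, mul_comm]
    _ ≤ w ^ n := by gcongr

end Sampling

/-! ### Sums of squares over a rare event -/

section LargeCoordinates

variable {Ω : Type*} [MeasurableSpace Ω] {μ : Measure Ω} [IsProbabilityMeasure μ]
  {Ω' : Type*} [MeasurableSpace Ω'] {P : Measure Ω'} {N : ℕ} {X : Fin N → Ω' → Ω}

/-- Either `a` is below the threshold `K * w`, or one factor `a` may be traded for `a³`. Integrated
over a rare event, the cube costs a higher moment, while the threshold is multiplied by the small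
measure of the event. -/
theorem le_cube_div_sq_add {a K w : ℝ} (ha : 0 ≤ a) (hK : 0 < K) (hw : 0 < w) :
    a ≤ a ^ 3 / (K ^ 2 * w ^ 2) + K * w := by
  rcases le_total a (K * w) with h | h
  · have : 0 ≤ a ^ 3 / (K ^ 2 * w ^ 2) := by positivity
    linarith
  · have h1 : a ≤ a ^ 3 / (K ^ 2 * w ^ 2) := by
      rw [le_div_iff₀ (by positivity), ← mul_pow, pow_succ' a 2]
      gcongr
    have : 0 < K * w := by positivity
    linarith

/-- Moments of a variable with subgaussian moment growth, restricted to a small event. -/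
theorem integral_indicator_pow_le {U : Ω → ℝ} (hU : Measurable U) {p A y : ℝ} (hA : 0 < A)
    (h : gradedNorm μ p U ≤ ENNReal.ofReal A) (hy : 0 < y) {B : Set Ω} (hB : MeasurableSet B)
    (hBy : μ.real B * y ^ 12 ≤ 2) {j : ℕ} (hj : 1 ≤ j) (hjp : 6 * (j : ℝ) ≤ p) :
    Integrable (fun x => (B.indicator (fun x => U x ^ 2) x) ^ j) μ ∧
      ∫ x, (B.indicator (fun x => U x ^ 2) x) ^ j ∂μ ≤ 3 / y ^ 8 * (6 * j * A ^ 2) ^ j := by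
  set K : ℝ := (6 * j * A ^ 2) ^ j with hK
  have hj0 : (0 : ℝ) < j := by exact_mod_cast hj
  have hK0 : 0 < K := by positivity
  obtain ⟨hi, hle⟩ := integrable_pow_and_integral_le_of_gradedNorm (k := 6 * j) hU hA.le h
    (by omega) (by push_cast; exact hjp)
  have hK3 : (A * √((6 * j : ℕ) : ℝ)) ^ (6 * j) = K ^ 3 := by
    have : (A * √((6 * j : ℕ) : ℝ)) ^ 2 = 6 * j * A ^ 2 := by
      rw [mul_pow, Real.sq_sqrt (by positivity)]
      push_cast
      ring
    rw [show 6 * j = 2 * (j * 3) by ring, pow_mul, ← show 6 * j = 2 * (j * 3) by ring, this, hK,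
      pow_mul]
  rw [hK3] at hle
  -- The threshold parameter is `w = y ^ 4`: the sixth-power moment then contributes `K / y ^ 8`,
  -- and `μ(B) ≤ 2 / y ^ 12` makes the other term at most `2 K / y ^ 8`.
  have hpt : ∀ x, (B.indicator (fun x => U x ^ 2) x) ^ j ≤
      |U x| ^ (6 * j) / (K ^ 2 * y ^ 8) + B.indicator (fun _ => K * y ^ 4) x := fun x => by
    by_cases hx : x ∈ B
    · simp only [Set.indicator_of_mem hx]
      have := le_cube_div_sq_add (a := (U x ^ 2) ^ j) (by positivity) hK0
        (show 0 < y ^ 4 by positivity)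
      have e : ((U x ^ 2) ^ j) ^ 3 = |U x| ^ (6 * j) := by
        rw [← sq_abs, ← pow_mul, ← pow_mul]
        congr 1
        ring
      rw [e, ← pow_mul y] at this
      exact this
    · simp only [Set.indicator_of_notMem hx]
      rw [zero_pow (by omega)]
      positivity
  have hdom : Integrable (fun x => |U x| ^ (6 * j) / (K ^ 2 * y ^ 8) +
      B.indicator (fun _ => K * y ^ 4) x) μ :=
    (hi.div_const _).add ((integrable_const _).indicator hB)
  have hint : Integrable (fun x => (B.indicator (fun x => U x ^ 2) x) ^ j) μ := by
    refine hdom.mono' (((hU.pow_const 2).indicator hB).pow_const j).aestronglyMeasurable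
      (ae_of_all _ fun x => ?_)
    rw [Real.norm_eq_abs, abs_of_nonneg]
    · exact hpt x
    · exact pow_nonneg (Set.indicator_nonneg (fun _ _ => by positivity) _) _
  refine ⟨hint, (integral_mono hint hdom hpt).trans ?_⟩
  rw [integral_add (hi.div_const _) ((integrable_const _).indicator hB), integral_div,
    integral_indicator_const _ hB, smul_eq_mul]
  have h1 : (∫ x, |U x| ^ (6 * j) ∂μ) / (K ^ 2 * y ^ 8) ≤ K / y ^ 8 := by
    rw [div_le_div_iff₀ (by positivity) (by positivity)]
    calc _ ≤ K ^ 3 * y ^ 8 := by gcongr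
      _ = _ := by ring
  have h2 : μ.real B * (K * y ^ 4) ≤ 2 * K / y ^ 8 := by
    rw [le_div_iff₀ (by positivity)]
    calc _ = (μ.real B * y ^ 12) * K := by ring
      _ ≤ _ := by gcongr
  calc _ ≤ K / y ^ 8 + 2 * K / y ^ 8 := add_le_add h1 h2
    _ = _ := by ring

/-- The squares of a variable with subgaussian moment growth, sampled on a small event. -/
theorem measure_sum_indicator_sq_ge_le (hX : ∀ i, MeasurePreserving (X i) P μ)
    (hind : iIndepFun X P) {U : Ω → ℝ} (hU : Measurable U) {p A y : ℝ} (hp : 64 ≤ p)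
    (hA : 0 < A) (h : gradedNorm μ p U ≤ ENNReal.ofReal A) (hy : 0 < y) (hN : N = p * y ^ 8)
    {B : Set Ω} (hB : MeasurableSet B) (hBy : μ.real B * y ^ 12 ≤ 2) :
    P {ω | Real.exp 64 * p * A ^ 2 ≤ ∑ i, B.indicator (fun x => U x ^ 2) (X i ω)} ≤
      ENNReal.ofReal (Real.exp (-(2 * p))) := by
  set Y : Ω → ℝ := B.indicator (fun x => U x ^ 2) with hY
  have hY0 : ∀ x, 0 ≤ Y x := fun x => Set.indicator_nonneg (fun _ _ => by positivity) _
  have hYm : Measurable Y := (hU.pow_const 2).indicator hB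
  -- The `j`-th moment of `Y` needs the moment of `U` of order `6 j`, which is available only up to
  -- `p`.
  set n : ℕ := ⌊p / 6⌋₊ with hn
  have hn1 : (n : ℝ) ≤ p / 6 := Nat.floor_le (by positivity)
  have hn2 : p / 6 < n + 1 := Nat.lt_floor_add_one _
  -- Chosen so that `z * 6 * A ^ 2 = 1 / (2 e)`; with `j ^ j / j! ≤ e ^ j`, the `j`-th term of the
  -- series is at most `3 / y ^ 8 * 2 ^ (-j)`.
  set z : ℝ := 1 / (12 * Real.exp 1 * A ^ 2) with hz
  have hz0 : 0 < z := by positivity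
  have hmom : ∀ j ∈ Finset.range n, Integrable (fun x => (z * Y x) ^ (j + 1) /
      ((j + 1).factorial : ℝ)) μ ∧
      ∫ x, (z * Y x) ^ (j + 1) / ((j + 1).factorial : ℝ) ∂μ ≤
        3 / y ^ 8 * (1 / 2 * (1 / 2 : ℝ) ^ j) := fun j hj => by
    have hj' : j + 1 ≤ n := Finset.mem_range.1 hj
    have hjn : ((j + 1 : ℕ) : ℝ) ≤ n := by exact_mod_cast hj'
    obtain ⟨hi, hle⟩ := integral_indicator_pow_le (j := j + 1) hU hA h hy hB hBy (by omega)
      (by linarith)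
    have e : ∀ x, (z * Y x) ^ (j + 1) / ((j + 1).factorial : ℝ) =
        z ^ (j + 1) / ((j + 1).factorial : ℝ) * Y x ^ (j + 1) := fun x => by
      rw [mul_pow]; ring
    simp only [e]
    refine ⟨hi.const_mul _, ?_⟩
    rw [integral_const_mul]
    refine (mul_le_mul_of_nonneg_left hle (by positivity)).trans ?_
    have h1 := Real.pow_div_factorial_le_exp ((j + 1 : ℕ) : ℝ) (by positivity) (j + 1)
    have h2 : Real.exp ((j + 1 : ℕ) : ℝ) = Real.exp 1 ^ (j + 1) := by
      rw [← Real.exp_nat_mul, mul_one]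
    rw [h2] at h1
    have e2 : z ^ (j + 1) / ((j + 1).factorial : ℝ) *
        (3 / y ^ 8 * (6 * ((j + 1 : ℕ) : ℝ) * A ^ 2) ^ (j + 1)) =
        3 / y ^ 8 * ((z * 6 * A ^ 2) ^ (j + 1) *
          (((j + 1 : ℕ) : ℝ) ^ (j + 1) / ((j + 1).factorial : ℝ))) := by
      simp only [mul_pow]; ring
    rw [e2]
    have e3 : (1 / 2 * (1 / 2 : ℝ) ^ j) = (z * 6 * A ^ 2) ^ (j + 1) * Real.exp 1 ^ (j + 1) := by
      rw [← pow_succ', ← mul_pow]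
      congr 1
      rw [hz]
      have := Real.exp_pos 1
      field_simp
      norm_num
    rw [e3]
    gcongr
  have hg : ∀ x, truncExp n (z * Y x) =
      1 + ∑ j ∈ Finset.range n, (z * Y x) ^ (j + 1) / ((j + 1).factorial : ℝ) := fun x => by
    rw [truncExp, Finset.sum_range_succ']
    simp [add_comm]
  have hgi : Integrable (fun x => truncExp n (z * Y x)) μ := by
    simp only [hg]
    exact (integrable_const _).add (integrable_finsetSum _ fun j hj => (hmom j hj).1)
  have hgE : ∫ x, truncExp n (z * Y x) ∂μ ≤ Real.exp (3 / y ^ 8) := by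
    simp only [hg]
    rw [integral_add (integrable_const _) (integrable_finsetSum _ fun j hj => (hmom j hj).1),
      integral_finsetSum _ fun j hj => (hmom j hj).1]
    have h1 : ∑ j ∈ Finset.range n, ∫ x, (z * Y x) ^ (j + 1) / ((j + 1).factorial : ℝ) ∂μ ≤
        3 / y ^ 8 := by
      refine (Finset.sum_le_sum fun j hj => (hmom j hj).2).trans ?_
      rw [← Finset.mul_sum, ← Finset.mul_sum]
      have : ∑ j ∈ Finset.range n, (1 / 2 : ℝ) ^ j ≤ 2 := by
        simpa using sum_geometric_two_le n
      have h3 : 0 < 3 / y ^ 8 := by positivity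
      nlinarith
    have h2 := Real.add_one_le_exp (3 / y ^ 8)
    simp only [integral_const, probReal_univ, smul_eq_mul, mul_one]
    linarith
  have hgm : Measurable fun x => truncExp n (z * Y x) := by
    unfold truncExp
    fun_prop
  -- As `N * (3 / y ^ 8) = 3 * p`, the level `5 * p` leaves probability `exp (-2p)`.
  have hmain := measure_exp_le_prod_le hX hind hgm
    (fun x => truncExp_nonneg n (mul_nonneg hz0.le (hY0 x))) (c := 3 / y ^ 8)
    (by
      rw [← ofReal_integral_eq_lintegral_ofReal hgi
        (ae_of_all _ fun x => truncExp_nonneg n (mul_nonneg hz0.le (hY0 x)))]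
      exact ENNReal.ofReal_le_ofReal hgE) (5 * p)
  have e : N * (3 / y ^ 8) - 5 * p = -(2 * p) := by
    rw [hN]; field_simp; ring
  rw [e] at hmain
  refine le_trans (measure_mono fun ω hω => ?_) hmain
  simp only [Set.mem_ofPred_eq] at hω ⊢
  have h1 := truncExp_sum_le n Finset.univ (t := fun i => z * Y (X i ω))
    fun i => mul_nonneg hz0.le (hY0 _)
  refine le_trans ?_ h1
  rw [← Finset.mul_sum]
  have hn0 : n ≠ 0 := by
    intro h0
    rw [h0] at hn2
    norm_num at hn2
    linarith
  -- The exponent `60` is large enough because `n > p / 6 - 1` and `p ≥ 64` give `60 * n ≥ 5 * p`.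
  have h2 : (n : ℝ) * Real.exp 60 ≤ z * ∑ i, Y (X i ω) := by
    refine le_trans ?_ (mul_le_mul_of_nonneg_left hω hz0.le)
    have e4 : Real.exp 64 = Real.exp 60 * Real.exp 1 ^ 3 * Real.exp 1 := by
      rw [← Real.exp_nat_mul, ← Real.exp_add, ← Real.exp_add]; norm_num
    have e5 : z * (Real.exp 64 * p * A ^ 2) = Real.exp 1 ^ 3 / 12 * (p * Real.exp 60) := by
      rw [e4, hz]
      field_simp
    rw [e5]
    have h5 : (12 : ℝ) ≤ Real.exp 1 ^ 3 := by
      have := Real.exp_one_gt_d9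
      calc (12 : ℝ) ≤ 2.7 ^ 3 := by norm_num
        _ ≤ _ := by gcongr; linarith
    have h6 : (n : ℝ) ≤ p := by linarith
    have h7 : 1 ≤ Real.exp 1 ^ 3 / 12 := by linarith
    calc (n : ℝ) * Real.exp 60 ≤ 1 * (p * Real.exp 60) := by rw [one_mul]; gcongr
      _ ≤ _ := by gcongr
  refine le_trans ?_ (exp_mul_le_truncExp hn0 h2)
  rw [Real.exp_le_exp]
  linarith

end LargeCoordinates

/-! ### Deviation of a single product -/

section Link

variable {Ω : Type*} [MeasurableSpace Ω] {μ : Measure Ω}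
  {Ω' : Type*} [MeasurableSpace Ω'] {P : Measure Ω'} {N : ℕ} {X : Fin N → Ω' → Ω}

theorem measureReal_lt_abs_mul_pow_le [IsProbabilityMeasure μ] {Z : Ω → ℝ} {k : ℕ} {a t : ℝ} (ht : 0 ≤ t)
    (hi : Integrable (fun x => |Z x| ^ k) μ) (hle : ∫ x, |Z x| ^ k ∂μ ≤ a) :
    μ.real {x | t < |Z x|} * t ^ k ≤ a := by
  have h := mul_meas_ge_le_integral_of_nonneg (ae_of_all μ fun x => by positivity) hi (t ^ k)
  refine le_trans ?_ (h.trans hle)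
  rw [mul_comm]
  refine mul_le_mul_of_nonneg_left (measureReal_mono fun x hx => ?_) (by positivity)
  exact pow_le_pow_left₀ ht (le_of_lt hx) k

theorem sq_mul_sq_le_of_fourth_powers (a b x y : ℝ) (ha : 0 < a) (hb : 0 < b) :
    (x * y) ^ 2 ≤ (b ^ 2 / (2 * a ^ 2)) * |x| ^ 4 + a ^ 2 / (2 * b ^ 2) * |y| ^ 4 := by
  have e : (b ^ 2 / (2 * a ^ 2)) * |x| ^ 4 + a ^ 2 / (2 * b ^ 2) * |y| ^ 4 - (x * y) ^ 2 =
      1 / 2 * (b / a * x ^ 2 - a / b * y ^ 2) ^ 2 := by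
    have h1 : |x| ^ 4 = x ^ 4 := Even.pow_abs ⟨2, rfl⟩ x
    have h2 : |y| ^ 4 = y ^ 4 := Even.pow_abs ⟨2, rfl⟩ y
    rw [h1, h2]
    field_simp
    ring
  have : 0 ≤ 1 / 2 * (b / a * x ^ 2 - a / b * y ^ 2) ^ 2 := by positivity
  linarith

theorem integrable_mul_sq_and_integral_le {U V : Ω → ℝ} (hU : Measurable U) (hV : Measurable V)
    {a b : ℝ} (ha : 0 < a) (hb : 0 < b)
    (hUi : Integrable (fun x => |U x| ^ 4) μ) (hUle : ∫ x, |U x| ^ 4 ∂μ ≤ a ^ 4)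
    (hVi : Integrable (fun x => |V x| ^ 4) μ) (hVle : ∫ x, |V x| ^ 4 ∂μ ≤ b ^ 4) :
    Integrable (fun x => (U x * V x) ^ 2) μ ∧ ∫ x, (U x * V x) ^ 2 ∂μ ≤ a ^ 2 * b ^ 2 := by
  have hd : Integrable (fun x => (b ^ 2 / (2 * a ^ 2)) * |U x| ^ 4 +
      a ^ 2 / (2 * b ^ 2) * |V x| ^ 4) μ := (hUi.const_mul _).add (hVi.const_mul _)
  have hint : Integrable (fun x => (U x * V x) ^ 2) μ := by
    refine hd.mono' ((hU.mul hV).pow_const 2).aestronglyMeasurable (ae_of_all _ fun x => ?_)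
    rw [Real.norm_eq_abs, abs_of_nonneg (by positivity)]
    exact sq_mul_sq_le_of_fourth_powers a b _ _ ha hb
  refine ⟨hint, (integral_mono hint hd fun x =>
    sq_mul_sq_le_of_fourth_powers a b _ _ ha hb).trans ?_⟩
  rw [integral_add (hUi.const_mul _) (hVi.const_mul _), integral_const_mul, integral_const_mul]
  calc _ ≤ (b ^ 2 / (2 * a ^ 2)) * a ^ 4 + a ^ 2 / (2 * b ^ 2) * b ^ 4 := by gcongr
    _ = _ := by field_simp; ring

/-- The level set outside of which the product of `U` and `V` is suitably bounded. -/
def peakSet (U V : Ω → ℝ) (s t : ℝ) : Set Ω := {x | s < |U x|} ∪ {x | t < |V x|}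

theorem measurableSet_peakSet {U V : Ω → ℝ} (hU : Measurable U) (hV : Measurable V) (s t : ℝ) :
    MeasurableSet (peakSet U V s t) :=
  (measurableSet_lt measurable_const hU.norm).union (measurableSet_lt measurable_const hV.norm)

/-- Markov's inequality with the sixteenth moment of `U` and the fourth moment of `V` gives `y ^
(-16) + y ^ (-12)`. For `y ≤ 1` both claims are trivial. The power `12` serves the sum of squares,
the power `8` the mean over the set. -/
theorem measureReal_peakSet_le [IsProbabilityMeasure μ]
    {U V : Ω → ℝ} {A b y : ℝ} (hA : 0 < A) (hb : 0 < b) (hy : 0 < y)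
    (hUi : Integrable (fun x => |U x| ^ 16) μ) (hUle : ∫ x, |U x| ^ 16 ∂μ ≤ (4 * A) ^ 16)
    (hVi : Integrable (fun x => |V x| ^ 4) μ) (hVle : ∫ x, |V x| ^ 4 ∂μ ≤ b ^ 4) :
    μ.real (peakSet U V (4 * A * y) (b * y ^ 3)) * y ^ 12 ≤ 2 ∧
      μ.real (peakSet U V (4 * A * y) (b * y ^ 3)) * y ^ 8 ≤ 2 := by
  have h1 := measureReal_lt_abs_mul_pow_le (t := 4 * A * y) (by positivity) hUi hUle
  have h2 := measureReal_lt_abs_mul_pow_le (t := b * y ^ 3) (by positivity) hVi hVle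
  have h1' : μ.real {x | 4 * A * y < |U x|} * y ^ 16 ≤ 1 := by
    rw [mul_pow] at h1
    have : 0 < (4 * A) ^ 16 := by positivity
    by_contra! hcon
    nlinarith
  have h2' : μ.real {x | b * y ^ 3 < |V x|} * y ^ 12 ≤ 1 := by
    rw [mul_pow] at h2
    have : 0 < b ^ 4 := by positivity
    by_contra! hcon
    nlinarith
  have h3 : μ.real (peakSet U V (4 * A * y) (b * y ^ 3)) ≤
      μ.real {x | 4 * A * y < |U x|} + μ.real {x | b * y ^ 3 < |V x|} := measureReal_union_le _ _
  have h4 : μ.real (peakSet U V (4 * A * y) (b * y ^ 3)) ≤ 1 := measureReal_le_one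
  have n1 : 0 ≤ μ.real {x | 4 * A * y < |U x|} := measureReal_nonneg
  have n2 : 0 ≤ μ.real {x | b * y ^ 3 < |V x|} := measureReal_nonneg
  have n3 : 0 ≤ μ.real (peakSet U V (4 * A * y) (b * y ^ 3)) := measureReal_nonneg
  rcases le_total y 1 with hy1 | hy1
  · have e1 : y ^ 12 ≤ 1 := pow_le_one₀ hy.le hy1
    have e2 : y ^ 8 ≤ 1 := pow_le_one₀ hy.le hy1
    constructor
    · nlinarith [mul_le_one₀ h4 (pow_pos hy 12).le e1]
    · nlinarith [mul_le_one₀ h4 (pow_pos hy 8).le e2]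
  · have e1 : y ^ 12 ≤ y ^ 16 := pow_le_pow_right₀ hy1 (by norm_num)
    have e2 : y ^ 8 ≤ y ^ 12 := pow_le_pow_right₀ hy1 (by norm_num)
    have key : μ.real (peakSet U V (4 * A * y) (b * y ^ 3)) * y ^ 12 ≤ 2 := by
      calc _ ≤ (μ.real {x | 4 * A * y < |U x|} + μ.real {x | b * y ^ 3 < |V x|}) * y ^ 12 := by
            gcongr
        _ = μ.real {x | 4 * A * y < |U x|} * y ^ 12 + μ.real {x | b * y ^ 3 < |V x|} * y ^ 12 := by
            ring
        _ ≤ μ.real {x | 4 * A * y < |U x|} * y ^ 16 + μ.real {x | b * y ^ 3 < |V x|} * y ^ 12 := by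
            gcongr
        _ ≤ 2 := by linarith
    exact ⟨key, le_trans (by gcongr) key⟩

/-- On `B`, `|Z| ≤ Z² / (2 c w) + c w / 2`; integrating this gives the bound, in the role of
Cauchy-Schwarz. -/
theorem abs_integral_indicator_mul_le [IsProbabilityMeasure μ]
    {Z : Ω → ℝ} {B : Set Ω} (hB : MeasurableSet B) {c w : ℝ} (hc : 0 < c) (hw : 0 < w)
    (hZi : Integrable (fun x => Z x ^ 2) μ) (hZle : ∫ x, Z x ^ 2 ∂μ ≤ c ^ 2)
    (hBw : μ.real B * w ^ 2 ≤ 2) : |∫ x, B.indicator Z x ∂μ| ≤ 3 / 2 * c / w := by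
  have hd : Integrable (fun x => 1 / (2 * c * w) * Z x ^ 2 +
      B.indicator (fun _ => c * w / 2) x) μ :=
    (hZi.const_mul _).add ((integrable_const _).indicator hB)
  have hpt : ∀ x, ‖B.indicator Z x‖ ≤ 1 / (2 * c * w) * Z x ^ 2 +
      B.indicator (fun _ => c * w / 2) x := fun x => by
    by_cases hx : x ∈ B
    · simp only [Set.indicator_of_mem hx, Real.norm_eq_abs]
      have e : 1 / (2 * c * w) * Z x ^ 2 + c * w / 2 - |Z x| =
          (|Z x| - c * w) ^ 2 / (2 * c * w) := by
        rw [← sq_abs]; field_simp; ring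
      have : 0 ≤ (|Z x| - c * w) ^ 2 / (2 * c * w) := by positivity
      linarith
    · simp only [Set.indicator_of_notMem hx, norm_zero]
      positivity
  have h1 := norm_integral_le_of_norm_le hd (ae_of_all μ hpt)
  rw [Real.norm_eq_abs, integral_add (hZi.const_mul _) ((integrable_const _).indicator hB),
    integral_const_mul, integral_indicator_const _ hB, smul_eq_mul] at h1
  refine h1.trans ?_
  have h2 : 1 / (2 * c * w) * ∫ x, Z x ^ 2 ∂μ ≤ 1 / 2 * c / w := by
    calc _ ≤ 1 / (2 * c * w) * c ^ 2 := by gcongr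
      _ = _ := by field_simp
  have h3 : μ.real B * (c * w / 2) ≤ c / w := by
    rw [le_div_iff₀ hw]
    calc _ = (μ.real B * w ^ 2) * c / 2 := by ring
      _ ≤ 2 * c / 2 := by gcongr
      _ = c := by ring
  calc _ ≤ 1 / 2 * c / w + c / w := add_le_add h2 h3
    _ = _ := by ring

/-- The event that the centred empirical sum of `U V` is controlled by a graded norm of `U` and
the empirical and population sizes of `V`. -/
def LinkBound (μ : Measure Ω) (p b : ℝ) (x : Fin N → Ω) (U V : Ω → ℝ) : Prop :=
  gradedNorm μ p U ≠ ∞ →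
    |∑ i, (U (x i) * V (x i) - ∫ z, U z * V z ∂μ)| ≤
      Real.exp 33 * √p * (gradedNorm μ p U).toReal * (√(∑ i, V (x i) ^ 2) + √N * b)

/-- Three terms are balanced: the bounded part off the peak set, the sample on it, and the mean over
it. The first and third are of order `√p A √N b`; the second produces the empirical norm of `V`. -/
theorem measure_lt_abs_sum_mul_sub_le [IsProbabilityMeasure μ]
    (hX : ∀ i, MeasurePreserving (X i) P μ)
    (hind : iIndepFun X P) {U V : Ω → ℝ} (hU : Measurable U) (hV : Measurable V)
    {p A b : ℝ} (hp : 64 ≤ p) (hN : N ≠ 0) (hA : 0 < A)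
    (h : gradedNorm μ p U ≤ ENNReal.ofReal A) (hb : 0 < b)
    (hVb : eLpNorm V 4 μ ≤ ENNReal.ofReal b) :
    P {ω | Real.exp 33 * √p * A * (√(∑ i, V (X i ω) ^ 2) + √N * b) <
        |∑ i, (U (X i ω) * V (X i ω) - ∫ z, U z * V z ∂μ)|} ≤
      3 * ENNReal.ofReal (Real.exp (-(2 * p))) := by
  have hp0 : 0 < p := by linarith
  have hN0 : (0 : ℝ) < N := by positivity
  -- The scale `y` is fixed by `N / y ^ 8 = p`, so that `√N = √p * y ^ 4`. It may be smaller than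
  -- `1`.
  obtain ⟨y, hy, hNy⟩ : ∃ y : ℝ, 0 < y ∧ (N : ℝ) = p * y ^ 8 := by
    refine ⟨(N / p) ^ ((1 : ℝ) / 8), by positivity, ?_⟩
    rw [← Real.rpow_natCast, ← Real.rpow_mul (by positivity)]
    norm_num
    field_simp
  obtain ⟨hU4, hU4le⟩ := integrable_pow_and_integral_le_of_gradedNorm (k := 4) hU hA.le h
    (by norm_num) (by norm_num; linarith)
  obtain ⟨hU16, hU16le⟩ := integrable_pow_and_integral_le_of_gradedNorm (k := 16) hU hA.le h
    (by norm_num) (by norm_num; linarith)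
  obtain ⟨hV4, hV4le⟩ := integrable_pow_and_integral_le (k := 4) hV (by norm_num) hb.le
    (by exact_mod_cast hVb)
  have s4 : √((4 : ℕ) : ℝ) = 2 := by
    rw [show ((4 : ℕ) : ℝ) = 2 ^ 2 by norm_num, Real.sqrt_sq (by norm_num)]
  have s16 : √((16 : ℕ) : ℝ) = 4 := by
    rw [show ((16 : ℕ) : ℝ) = 4 ^ 2 by norm_num, Real.sqrt_sq (by norm_num)]
  rw [s4] at hU4le
  rw [s16, mul_comm A 4] at hU16le
  set B := peakSet U V (4 * A * y) (b * y ^ 3) with hBdef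
  have hB : MeasurableSet B := measurableSet_peakSet hU hV _ _
  obtain ⟨hB12, hB8⟩ := measureReal_peakSet_le hA hb hy hU16 hU16le hV4 hV4le
  obtain ⟨hUVi, hUVle⟩ := integrable_mul_sq_and_integral_le hU hV (a := A * 2) (by positivity) hb
    hU4 hU4le hV4 hV4le
  set Z : Ω → ℝ := fun x => U x * V x with hZ
  have hZm : Measurable Z := hU.mul hV
  have hZint : Integrable Z μ := by
    have : MemLp Z 2 μ := (memLp_two_iff_integrable_sq hZm.aestronglyMeasurable).2 hUVi
    exact this.integrable (by norm_num)
  have hmean : |∫ x, B.indicator Z x ∂μ| ≤ 3 / 2 * (2 * A * b) / y ^ 4 := by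
    refine abs_integral_indicator_mul_le hB (by positivity) (by positivity) hUVi ?_ ?_
    · exact hUVle.trans (le_of_eq (by ring))
    · rw [← pow_mul]
      exact hB8
  set W : Ω → ℝ := Bᶜ.indicator Z with hW
  have hWm : Measurable W := hZm.indicator hB.compl
  set M : ℝ := 4 * A * b * y ^ 4 with hM
  have hM0 : 0 < M := by positivity
  have hWM : ∀ x, |W x| ≤ M := fun x => by
    by_cases hx : x ∈ B
    · rw [hW, Set.indicator_of_notMem (by simpa using hx), abs_zero]
      exact hM0.le
    · rw [hW, Set.indicator_of_mem (by simpa using hx), hZ, abs_mul]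
      simp only [hBdef, peakSet, Set.mem_union, Set.mem_ofPred_eq, not_or, not_lt] at hx
      calc |U x| * |V x| ≤ (4 * A * y) * (b * y ^ 3) := by gcongr <;> tauto
        _ = M := by rw [hM]; ring
  have hW2 : ∫ x, W x ^ 2 ∂μ ≤ 1 / y ^ 8 * M ^ 2 := by
    have h1 : ∫ x, W x ^ 2 ∂μ ≤ ∫ x, (U x * V x) ^ 2 ∂μ := by
      refine integral_mono_of_nonneg (ae_of_all _ fun x => by positivity) hUVi
        (ae_of_all _ fun x => ?_)
      by_cases hx : x ∈ B
      · simp only [hW, Set.indicator_of_notMem (show x ∉ Bᶜ by simpa using hx), zero_pow two_ne_zero]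
        positivity
      · simp only [hW, Set.indicator_of_mem (show x ∈ Bᶜ by simpa using hx), hZ, le_refl]
    refine (h1.trans hUVle).trans ?_
    have : 1 / y ^ 8 * M ^ 2 = 16 * (A ^ 2 * b ^ 2) := by
      rw [hM]; field_simp; ring
    rw [this]
    have : 0 < A ^ 2 * b ^ 2 := by positivity
    nlinarith
  have hexp : N * (1 / y ^ 8) - 3 * p = -(2 * p) := by
    rw [hNy]; field_simp; ring
  -- Here the variance term is `N / y ^ 8 = p`, so the level `3 * p` again leaves `exp (-2p)`. Both
  -- signs of `W` are needed.
  have b1 := measure_sum_sub_integral_ge_le hX hind hWm hM0 hWM hW2 (3 * p)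
  have b2 := measure_sum_sub_integral_ge_le hX hind (W := fun x => -W x) hWm.neg hM0
    (fun x => by rw [abs_neg]; exact hWM x) (by simpa only [neg_sq] using hW2) (3 * p)
  have b3 := measure_sum_indicator_sq_ge_le hX hind hU hp hA h hy hNy hB hB12
  rw [hexp] at b1 b2
  have e3 : 3 * ENNReal.ofReal (Real.exp (-(2 * p))) = ENNReal.ofReal (Real.exp (-(2 * p))) +
      ENNReal.ofReal (Real.exp (-(2 * p))) + ENNReal.ofReal (Real.exp (-(2 * p))) := by ring
  rw [e3]
  refine le_trans (le_trans (measure_mono fun ω hω => ?_) (measure_union_le _ _))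
    (add_le_add ((measure_union_le _ _).trans (add_le_add b1 b2)) b3)
  by_contra hcon
  simp only [Set.mem_union, Set.mem_ofPred_eq, not_or, not_le] at hcon hω
  obtain ⟨⟨c1, c2⟩, c3⟩ := hcon
  refine absurd hω (not_lt.2 ?_)
  have sN : √(N : ℝ) = √p * y ^ 4 := by
    rw [hNy, Real.sqrt_mul hp0.le, show y ^ 8 = (y ^ 4) ^ 2 by ring, Real.sqrt_sq (by positivity)]
  have sp : √p * √p = p := Real.mul_self_sqrt hp0.le
  have hsplit : ∀ x, Z x = W x + B.indicator Z x := fun x =>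
    (congrFun (Set.indicator_compl_add_self B Z) x).symm
  have hWint : Integrable W μ := hZint.indicator hB.compl
  have hBint : Integrable (B.indicator Z) μ := hZint.indicator hB
  have hEZ : ∫ z, Z z ∂μ = ∫ x, W x ∂μ + ∫ x, B.indicator Z x ∂μ := by
    rw [← integral_add hWint hBint]
    exact integral_congr_ae (ae_of_all _ hsplit)
  have hsum : ∑ i, (Z (X i ω) - ∫ z, Z z ∂μ) = ∑ i, (W (X i ω) - ∫ x, W x ∂μ) +
      ∑ i, B.indicator Z (X i ω) - N * ∫ x, B.indicator Z x ∂μ := by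
    rw [hEZ, Finset.sum_sub_distrib, Finset.sum_sub_distrib,
      Finset.sum_congr rfl fun i _ => hsplit (X i ω), Finset.sum_add_distrib]
    simp only [Finset.sum_const, Finset.card_univ, Fintype.card_fin, nsmul_eq_mul]
    ring
  have t1 : |∑ i, (W (X i ω) - ∫ x, W x ∂μ)| ≤ 3 * p * M := by
    rw [abs_le]
    refine ⟨?_, c1.le⟩
    rw [integral_neg] at c2
    have : ∑ i, (-W (X i ω) - -∫ x, W x ∂μ) = -∑ i, (W (X i ω) - ∫ x, W x ∂μ) := by
      rw [← Finset.sum_neg_distrib]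
      exact Finset.sum_congr rfl fun i _ => by ring
    rw [this] at c2
    linarith
  have t2 : |∑ i, B.indicator Z (X i ω)| ≤
      Real.exp 32 * √p * A * √(∑ i, V (X i ω) ^ 2) := by
    have e1 : ∀ i, B.indicator Z (X i ω) = B.indicator U (X i ω) * V (X i ω) := fun i => by
      rw [Set.indicator_mul_left]
    have e2 : ∀ i, B.indicator (fun x => U x ^ 2) (X i ω) = (B.indicator U (X i ω)) ^ 2 :=
      fun i => by by_cases hx : X i ω ∈ B <;> simp [hx]
    simp only [e1]
    simp only [e2] at c3
    have hcs := Finset.sum_mul_sq_le_sq_mul_sq Finset.univ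
      (fun i => B.indicator U (X i ω)) (fun i => V (X i ω))
    refine abs_le_of_sq_le_sq (hcs.trans ?_) (by positivity)
    have hV0 : 0 ≤ ∑ i, V (X i ω) ^ 2 := Finset.sum_nonneg fun i _ => by positivity
    rw [mul_pow, Real.sq_sqrt hV0, mul_pow, mul_pow, Real.sq_sqrt hp0.le, ← Real.exp_nat_mul]
    refine mul_le_mul_of_nonneg_right ?_ hV0
    norm_num
    exact c3.le
  have t3 : |N * ∫ x, B.indicator Z x ∂μ| ≤ 3 * A * b * p * y ^ 4 := by
    rw [abs_mul, abs_of_pos hN0]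
    calc (N : ℝ) * |∫ x, B.indicator Z x ∂μ| ≤ N * (3 / 2 * (2 * A * b) / y ^ 4) := by gcongr
      _ = _ := by rw [hNy]; field_simp
  change |∑ i, (Z (X i ω) - ∫ z, Z z ∂μ)| ≤ _
  rw [hsum]
  have hexp33 : Real.exp 32 ≤ Real.exp 33 := Real.exp_le_exp.2 (by norm_num)
  -- The bounded part contributes `3 * 4 = 12` and the mean over the peak set `3`, in units of `p A
  -- b y ^ 4`.
  have h15 : (15 : ℝ) ≤ Real.exp 33 := by
    have := Real.add_one_le_exp (33 : ℝ)
    linarith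
  calc |∑ i, (W (X i ω) - ∫ x, W x ∂μ) + ∑ i, B.indicator Z (X i ω) -
        N * ∫ x, B.indicator Z x ∂μ|
      ≤ |∑ i, (W (X i ω) - ∫ x, W x ∂μ)| + |∑ i, B.indicator Z (X i ω)| +
        |N * ∫ x, B.indicator Z x ∂μ| := (abs_sub _ _).trans (by gcongr; exact abs_add_le _ _)
    _ ≤ 3 * p * M + Real.exp 32 * √p * A * √(∑ i, V (X i ω) ^ 2) + 3 * A * b * p * y ^ 4 := by
        gcongr
    _ = Real.exp 32 * √p * A * √(∑ i, V (X i ω) ^ 2) + 15 * √p * A * (√N * b) := by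
        rw [hM, sN]
        linear_combination (-15 * A * b * y ^ 4) * sp
    _ ≤ Real.exp 33 * √p * A * √(∑ i, V (X i ω) ^ 2) +
        Real.exp 33 * √p * A * (√N * b) := by gcongr
    _ = _ := by ring

theorem measure_not_linkBound_le [IsProbabilityMeasure μ]
    (hX : ∀ i, MeasurePreserving (X i) P μ)
    (hind : iIndepFun X P) {U V : Ω → ℝ} (hU : Measurable U) (hV : Measurable V)
    {p b : ℝ} (hp : 64 ≤ p) (hN : N ≠ 0) (hb : 0 < b)
    (hVb : eLpNorm V 4 μ ≤ ENNReal.ofReal b) :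
    P {ω | ¬ LinkBound μ p b (fun i => X i ω) U V} ≤
      3 * ENNReal.ofReal (Real.exp (-(2 * p))) := by
  by_cases hfin : gradedNorm μ p U = ∞
  · simp [LinkBound, hfin]
  -- The deviation lemma needs a positive `A`. If the norm vanishes then `U = 0` almost everywhere,
  -- and the deviation is almost surely zero.
  by_cases h0 : gradedNorm μ p U = 0
  · have h1 := eLpNorm_le_gradedNorm (μ := μ) U (r := 1) (p := p) le_rfl (by linarith)
    rw [h0, zero_mul, ENNReal.ofReal_one, nonpos_iff_eq_zero,
      eLpNorm_eq_zero_iff hU.aestronglyMeasurable one_ne_zero] at h1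
    have h2 : ∫ z, U z * V z ∂μ = 0 := by
      rw [integral_congr_ae (g := fun _ => (0 : ℝ)), integral_zero]
      filter_upwards [h1] with z hz
      simp [hz]
    have h3 : ∀ᵐ ω ∂P, ∀ i, U (X i ω) = 0 :=
      ae_all_iff.2 fun i => (hX i).quasiMeasurePreserving.ae h1
    refine le_of_eq_of_le ?_ (zero_le)
    refine measure_mono_null ?_ (ae_iff.1 h3)
    intro ω hω
    simp only [Set.mem_ofPred_eq] at hω ⊢
    contrapose! hω
    simp [LinkBound, h0, h2, hω]
  · have hA : 0 < (gradedNorm μ p U).toReal := ENNReal.toReal_pos h0 hfin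
    refine le_trans (measure_mono fun ω hω => ?_) (measure_lt_abs_sum_mul_sub_le hX hind hU hV hp
      hN hA (ENNReal.ofReal_toReal hfin).ge hb hVb)
    simp only [Set.mem_ofPred_eq, LinkBound] at hω ⊢
    push Not at hω
    exact hω.2

end Link

/-! ### Union bound over all links -/

theorem IsAdmissible.encard_le {Ω : Type*} {F : Set (Ω → ℝ)} {A : ℕ → Set (Ω → ℝ)} (h : IsAdmissible F A)
    (s : ℕ) : (A s).encard ≤ ((2 ^ 2 ^ s : ℕ) : ℕ∞) := by
  rcases Nat.eq_zero_or_pos s with rfl | hs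
  · rw [h.card_zero]; norm_num
  · exact_mod_cast h.card_le s hs

section Union

variable {Ω : Type*} [MeasurableSpace Ω] {μ : Measure Ω}
  {Ω' : Type*} [MeasurableSpace Ω'] {P : Measure Ω'} {N : ℕ} {X : Fin N → Ω' → Ω}

theorem measure_exists_mem_le {α : Type*} {T : Set α} {n : ℕ} (hT : T.encard ≤ n)
    {p : α → Ω' → Prop} {ε : ℝ≥0∞} (h : ∀ t ∈ T, P {ω | p t ω} ≤ ε) :
    P {ω | ∃ t ∈ T, p t ω} ≤ n * ε := by
  obtain ⟨hfin, hcard⟩ := Set.encard_le_coe_iff_finite_ncard_le.1 hT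
  have e : {ω | ∃ t ∈ T, p t ω} = ⋃ t ∈ hfin.toFinset, {ω | p t ω} := by
    ext ω; simp
  rw [e]
  refine (measure_biUnion_finset_le _ _).trans ?_
  refine (Finset.sum_le_card_nsmul _ _ ε fun t ht => h t (hfin.mem_toFinset.1 ht)).trans ?_
  rw [nsmul_eq_mul, ← Set.ncard_eq_toFinset_card T hfin]
  gcongr

/-- All links between consecutive levels of `A`, tested against the elements of `A'`. -/
def LinksHold (μ : Measure Ω) (u b : ℝ) (s₀ : ℕ) (x : Fin N → Ω) (A A' : ℕ → Set (Ω → ℝ)) :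
    Prop :=
  (∀ f ∈ A s₀, ∀ v ∈ A' s₀, LinkBound μ (u ^ 2 * 2 ^ s₀) b x f v) ∧
    ∀ k, ∀ f₀ ∈ A (s₀ + k), ∀ f₁ ∈ A (s₀ + k + 1), ∀ v ∈ A' (s₀ + k) ∪ A' (s₀ + k + 1),
      LinkBound μ (u ^ 2 * 2 ^ (s₀ + k)) b x (f₁ - f₀) v

/-- At level `s₀ + k` there are at most `2 ^ (6 w)` links, `w = 2 ^ (s₀ + k)`. Since `u² ≥ 64`, half
of the exponent `2 u² w` absorbs this count and a geometric weight; the other half is at least `u² 2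
^ s₀`. -/
theorem link_failure_bound {u : ℝ} (hu : 8 ≤ u) (s₀ k : ℕ) :
    ((2 ^ (6 * 2 ^ (s₀ + k)) : ℕ) : ℝ≥0∞) *
      (3 * ENNReal.ofReal (Real.exp (-(2 * (u ^ 2 * 2 ^ (s₀ + k)))))) ≤
      ENNReal.ofReal (Real.exp (-(u ^ 2 * 2 ^ s₀)) * (1 / 8 * (1 / 2) ^ k)) := by
  set w : ℝ := 2 ^ (s₀ + k) with hw
  have hu2 : 64 ≤ u ^ 2 := by nlinarith
  have hw0 : (2 : ℝ) ^ s₀ ≤ w := pow_le_pow_right₀ (by norm_num) (by omega)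
  have hwk : (k : ℝ) + 1 ≤ w := by
    have h1 : k + 1 ≤ 2 ^ (s₀ + k) :=
      (Nat.lt_two_pow_self (n := k)).trans_le (Nat.pow_le_pow_right (by norm_num) (by omega))
    rw [hw]
    exact_mod_cast h1
  have h2 : ∀ n : ℕ, (2 : ℝ) ^ n ≤ Real.exp n := fun n => by
    rw [← mul_one (n : ℝ), Real.exp_nat_mul]
    have := Real.add_one_le_exp 1
    gcongr
    linarith
  have e : ((2 ^ (6 * 2 ^ (s₀ + k)) : ℕ) : ℝ≥0∞) *
      (3 * ENNReal.ofReal (Real.exp (-(2 * (u ^ 2 * w))))) =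
      ENNReal.ofReal (((2 ^ (6 * 2 ^ (s₀ + k)) : ℕ) : ℝ) * (3 * Real.exp (-(2 * (u ^ 2 * w))))) := by
    rw [ENNReal.ofReal_mul (by positivity), ENNReal.ofReal_mul (by norm_num),
      ENNReal.ofReal_natCast, ENNReal.ofReal_ofNat]
  rw [e]
  refine ENNReal.ofReal_le_ofReal ?_
  have h3 : ((2 ^ (6 * 2 ^ (s₀ + k)) : ℕ) : ℝ) ≤ Real.exp (6 * w) := by
    push_cast
    refine (h2 _).trans (le_of_eq ?_)
    rw [hw]
    push_cast
    rfl
  have h4 : (1 / 8 * (1 / 2) ^ k : ℝ) = 1 / 2 ^ (k + 3) := by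
    rw [one_div_pow, pow_add]; ring
  have h5 : (2 : ℝ) ^ (k + 3) * 3 ≤ Real.exp (k + 5) := by
    calc (2 : ℝ) ^ (k + 3) * 3 ≤ 2 ^ (k + 3) * 4 := by gcongr; norm_num
      _ = 2 ^ (k + 5) := by ring
      _ ≤ _ := by simpa using h2 (k + 5)
  rw [h4, mul_one_div, le_div_iff₀ (by positivity)]
  calc ((2 ^ (6 * 2 ^ (s₀ + k)) : ℕ) : ℝ) * (3 * Real.exp (-(2 * (u ^ 2 * w)))) * 2 ^ (k + 3)
      = ((2 ^ (6 * 2 ^ (s₀ + k)) : ℕ) : ℝ) * Real.exp (-(2 * (u ^ 2 * w))) * (2 ^ (k + 3) * 3) := by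
        ring
    _ ≤ Real.exp (6 * w) * Real.exp (-(2 * (u ^ 2 * w))) * Real.exp (k + 5) := by gcongr
    _ = Real.exp (6 * w + -(2 * (u ^ 2 * w)) + (k + 5)) := by
        rw [← Real.exp_add, ← Real.exp_add]
    _ ≤ _ := by
        rw [Real.exp_le_exp]
        have h6 : u ^ 2 * 2 ^ s₀ ≤ u ^ 2 * w := by gcongr
        have h7 : 64 * w ≤ u ^ 2 * w := by
          have : 0 ≤ w := by positivity
          gcongr
        have : (0 : ℝ) ≤ k := by positivity
        linarith

theorem measure_not_linksHold_le [IsProbabilityMeasure μ]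
    (hX : ∀ i, MeasurePreserving (X i) P μ) (hind : iIndepFun X P) (hN : N ≠ 0)
    {u b : ℝ} (hu : 8 ≤ u) (hb : 0 < b) (s₀ : ℕ) {F H : Set (Ω → ℝ)} {A A' : ℕ → Set (Ω → ℝ)}
    (hA : IsAdmissible F A) (hA' : IsAdmissible H A') (hAm : ∀ s, ∀ f ∈ A s, Measurable f)
    (hAm' : ∀ s, ∀ f ∈ A' s, Measurable f)
    (hbA' : ∀ s, ∀ v ∈ A' s, eLpNorm v 4 μ ≤ ENNReal.ofReal b) :
    P {ω | ¬ LinksHold μ u b s₀ (fun i => X i ω) A A'} ≤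
      ENNReal.ofReal (1 / 2 * Real.exp (-(u ^ 2 * 2 ^ s₀))) := by
  have hp : ∀ s : ℕ, 64 ≤ u ^ 2 * 2 ^ s := fun s => by
    have h1 : (1 : ℝ) ≤ 2 ^ s := one_le_pow₀ (by norm_num)
    nlinarith
  set E := Real.exp (-(u ^ 2 * 2 ^ s₀)) with hE
  have hE0 : 0 < E := Real.exp_pos _
  have base : P {ω | ∃ t ∈ A s₀ ×ˢ A' s₀,
      ¬ LinkBound μ (u ^ 2 * 2 ^ s₀) b (fun i => X i ω) t.1 t.2} ≤
        ENNReal.ofReal (E * (1 / 8)) := by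
    have hcard : (A s₀ ×ˢ A' s₀).encard ≤ ((2 ^ (6 * 2 ^ s₀) : ℕ) : ℕ∞) := by
      rw [Set.encard_prod]
      refine (mul_le_mul' (hA.encard_le s₀) (hA'.encard_le s₀)).trans ?_
      rw [← Nat.cast_mul, ← pow_add]
      exact_mod_cast Nat.pow_le_pow_right (by norm_num) (by omega)
    refine (measure_exists_mem_le hcard fun t ht => measure_not_linkBound_le hX hind
      (hAm _ _ ht.1) (hAm' _ _ ht.2) (hp s₀) hN hb (hbA' _ _ ht.2)).trans ?_
    simpa using link_failure_bound hu s₀ 0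
  have step : ∀ k, P {ω | ∃ t ∈ (A (s₀ + k) ×ˢ A (s₀ + k + 1)) ×ˢ
      (A' (s₀ + k) ∪ A' (s₀ + k + 1)),
      ¬ LinkBound μ (u ^ 2 * 2 ^ (s₀ + k)) b (fun i => X i ω) (t.1.2 - t.1.1) t.2} ≤
        ENNReal.ofReal (E * (1 / 8 * (1 / 2) ^ k)) := fun k => by
    have hcard : ((A (s₀ + k) ×ˢ A (s₀ + k + 1)) ×ˢ
        (A' (s₀ + k) ∪ A' (s₀ + k + 1))).encard ≤ ((2 ^ (6 * 2 ^ (s₀ + k)) : ℕ) : ℕ∞) := by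
      rw [Set.encard_prod, Set.encard_prod]
      have h1 : (A' (s₀ + k) ∪ A' (s₀ + k + 1)).encard ≤
          ((2 ^ 2 ^ (s₀ + k) + 2 ^ 2 ^ (s₀ + k + 1) : ℕ) : ℕ∞) := by
        refine (Set.encard_union_le _ _).trans ?_
        rw [Nat.cast_add]
        exact add_le_add (hA'.encard_le _) (hA'.encard_le _)
      refine (mul_le_mul' (mul_le_mul' (hA.encard_le _) (hA.encard_le _)) h1).trans ?_
      rw [← Nat.cast_mul, ← Nat.cast_mul]
      -- With `m = 2 ^ (s₀ + k)` the count is at most `2 ^ m * 2 ^ (2m) * (2 ^ m + 2 ^ (2m)) ≤ 2 ^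
      -- (5m + 1)`.
      norm_cast
      set m := 2 ^ (s₀ + k) with hm
      have hm1 : 1 ≤ m := Nat.one_le_two_pow
      have hm2 : 2 ^ (s₀ + k + 1) = 2 * m := by rw [pow_succ]; ring
      rw [hm2]
      have h2 : 2 ^ m ≤ 2 ^ (2 * m) := Nat.pow_le_pow_right (by norm_num) (by omega)
      calc 2 ^ m * 2 ^ (2 * m) * (2 ^ m + 2 ^ (2 * m))
          ≤ 2 ^ m * 2 ^ (2 * m) * (2 ^ (2 * m) + 2 ^ (2 * m)) := by gcongr
        _ = 2 ^ (5 * m + 1) := by ring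
        _ ≤ _ := Nat.pow_le_pow_right (by norm_num) (by omega)
    refine (measure_exists_mem_le hcard fun t ht => measure_not_linkBound_le hX hind
      ((hAm _ _ ht.1.2).sub (hAm _ _ ht.1.1)) ?_ (hp _) hN hb ?_).trans
      (link_failure_bound hu s₀ k)
    · exact ht.2.elim (hAm' _ _) (hAm' _ _)
    · exact ht.2.elim (hbA' _ _) (hbA' _ _)
  have hsum : ∑' k, ENNReal.ofReal (E * (1 / 8 * (1 / 2) ^ k)) = ENNReal.ofReal (E * (1 / 4)) := by
    have hs : HasSum (fun k : ℕ => E * (1 / 8 * (1 / 2 : ℝ) ^ k)) (E * (1 / 8 * 2)) :=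
      (hasSum_geometric_two.mul_left _).mul_left _
    rw [← ENNReal.ofReal_tsum_of_nonneg (fun k => by positivity) hs.summable, hs.tsum_eq]
    norm_num
  calc P {ω | ¬ LinksHold μ u b s₀ (fun i => X i ω) A A'}
      ≤ P ({ω | ∃ t ∈ A s₀ ×ˢ A' s₀,
          ¬ LinkBound μ (u ^ 2 * 2 ^ s₀) b (fun i => X i ω) t.1 t.2} ∪
        ⋃ k, {ω | ∃ t ∈ (A (s₀ + k) ×ˢ A (s₀ + k + 1)) ×ˢ (A' (s₀ + k) ∪ A' (s₀ + k + 1)),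
          ¬ LinkBound μ (u ^ 2 * 2 ^ (s₀ + k)) b (fun i => X i ω) (t.1.2 - t.1.1) t.2}) := by
        refine measure_mono fun ω hω => ?_
        by_contra hcon
        simp only [Set.mem_union, Set.mem_iUnion, Set.mem_ofPred_eq, not_or, not_exists, not_and,
          not_not] at hcon hω
        refine hω ⟨fun f hf v hv => hcon.1 (f, v) ⟨hf, hv⟩, fun k f₀ h₀ f₁ h₁ v hv =>
          hcon.2 k ((f₀, f₁), v) ⟨⟨h₀, h₁⟩, hv⟩⟩
    _ ≤ ENNReal.ofReal (E * (1 / 8)) + ENNReal.ofReal (E * (1 / 4)) := by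
        refine (measure_union_le _ _).trans (add_le_add base ?_)
        rw [← hsum]
        exact (measure_iUnion_le _).trans (ENNReal.tsum_le_tsum step)
    _ ≤ _ := by
        rw [← ENNReal.ofReal_add (by positivity) (by positivity)]
        exact ENNReal.ofReal_le_ofReal (by linarith)

end Union

/-! ### Chaining the product and bounding empirical norms -/

section Chaining

variable {Ω : Type*} [MeasurableSpace Ω] {μ : Measure Ω} {N : ℕ}

/-- Chains `π` through the levels `A` whose increments and starting points are controlled by `L`,
inside a class that is bounded by `b` in `L₄`. -/
structure IsChain (μ : Measure Ω) (u : ℝ) (s₀ : ℕ) (F : Set (Ω → ℝ)) (A : ℕ → Set (Ω → ℝ))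
    (π : ℕ → (Ω → ℝ) → (Ω → ℝ)) (L b : ℝ) : Prop where
  measurable : ∀ s, ∀ f ∈ A s, Measurable f
  finite : ∀ s, (A s).Finite
  mem : ∀ s, ∀ f ∈ F, π s f ∈ A s
  eLpNorm_le : ∀ s, ∀ v ∈ A s, eLpNorm v 4 μ ≤ ENNReal.ofReal b
  start_ne_top : ∀ f ∈ F, gradedNorm μ (u ^ 2 * 2 ^ s₀) (π s₀ f) ≠ ∞
  start_le : ∀ f ∈ F, √(u ^ 2 * 2 ^ s₀) * (gradedNorm μ (u ^ 2 * 2 ^ s₀) (π s₀ f)).toReal ≤ u * L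
  incr_ne_top : ∀ f ∈ F, ∀ k,
    gradedNorm μ (u ^ 2 * 2 ^ (s₀ + k)) (π (s₀ + k + 1) f - π (s₀ + k) f) ≠ ∞
  incr_le : ∀ f ∈ F, ∀ n, ∑ k ∈ Finset.range n, √(u ^ 2 * 2 ^ (s₀ + k)) *
    (gradedNorm μ (u ^ 2 * 2 ^ (s₀ + k)) (π (s₀ + k + 1) f - π (s₀ + k) f)).toReal ≤ 2 * (u * L)

/-- The centred empirical sum of the product of two functions. -/
noncomputable def prodDev (μ : Measure Ω) (x : Fin N → Ω) (U V : Ω → ℝ) : ℝ :=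
  ∑ i, (U (x i) * V (x i) - ∫ z, U z * V z ∂μ)

theorem prodDev_comm (x : Fin N → Ω) (U V : Ω → ℝ) : prodDev μ x U V = prodDev μ x V U := by
  simp only [prodDev, mul_comm]

theorem prodDev_sub_left (x : Fin N → Ω) {U U' V : Ω → ℝ}
    (h : Integrable (fun z => U z * V z) μ) (h' : Integrable (fun z => U' z * V z) μ) :
    prodDev μ x (U - U') V = prodDev μ x U V - prodDev μ x U' V := by
  have e : ∫ z, (U - U') z * V z ∂μ = ∫ z, U z * V z ∂μ - ∫ z, U' z * V z ∂μ := by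
    rw [← integral_sub h h']
    simp only [Pi.sub_apply, sub_mul]
  rw [prodDev, prodDev, prodDev, ← Finset.sum_sub_distrib, e]
  refine Finset.sum_congr rfl fun i _ => ?_
  simp only [Pi.sub_apply]
  ring

theorem memLp_two_mul [IsProbabilityMeasure μ] {U V : Ω → ℝ} (hU : Measurable U)
    (hV : Measurable V) {a b : ℝ} (ha : 0 < a) (hb : 0 < b)
    (hUa : eLpNorm U 4 μ ≤ ENNReal.ofReal a)
    (hVb : eLpNorm V 4 μ ≤ ENNReal.ofReal b) :
    MemLp (fun z => U z * V z) 2 μ ∧ ∫ z, (U z * V z) ^ 2 ∂μ ≤ (a * b) ^ 2 := by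
  obtain ⟨hU4, hU4le⟩ := integrable_pow_and_integral_le (k := 4) hU (by norm_num) ha.le
    (by exact_mod_cast hUa)
  obtain ⟨hV4, hV4le⟩ := integrable_pow_and_integral_le (k := 4) hV (by norm_num) hb.le
    (by exact_mod_cast hVb)
  obtain ⟨h1, h2⟩ := integrable_mul_sq_and_integral_le hU hV ha hb hU4 hU4le hV4 hV4le
  exact ⟨(memLp_two_iff_integrable_sq (hU.mul hV).aestronglyMeasurable).2 h1,
    h2.trans (le_of_eq (mul_pow a b 2).symm)⟩

theorem integral_sq_le_of_eLpNorm_four_le [IsProbabilityMeasure μ] {U : Ω → ℝ} (hU : Measurable U)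
    {a : ℝ} (ha : 0 < a) (hUa : eLpNorm U 4 μ ≤ ENNReal.ofReal a) :
    ∫ z, U z * U z ∂μ ≤ a ^ 2 := by
  have h2 : eLpNorm U (2 : ℕ) μ ≤ ENNReal.ofReal a :=
    (eLpNorm_le_eLpNorm_of_exponent_le (by norm_num) hU.aestronglyMeasurable).trans hUa
  have h := (integrable_pow_and_integral_le hU two_ne_zero ha.le h2).2
  simpa [pow_two] using h

/-- The two chains advance alternately, so every step is a link: an increment of one chain against a
current point of the other. The pair of starting points is a link charged to `L` alone, hence the
coefficients `3 = 1 + 2` and `2`. -/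
theorem abs_prodDev_chain_le [IsProbabilityMeasure μ] {u : ℝ} {s₀ : ℕ}
    {F H : Set (Ω → ℝ)} {A A' : ℕ → Set (Ω → ℝ)} {π π' : ℕ → (Ω → ℝ) → (Ω → ℝ)}
    {L L' b b' : ℝ} (hb : 0 < b) (hb' : 0 < b')
    (hF : IsChain μ u s₀ F A π L b) (hH : IsChain μ u s₀ H A' π' L' b') {x : Fin N → Ω}
    (h : LinksHold μ u b' s₀ x A A') (h' : LinksHold μ u b s₀ x A' A)
    {f g : Ω → ℝ} (hf : f ∈ F) (hg : g ∈ H) (n : ℕ) {R R' : ℝ}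
    (hR : ∀ k ≤ n, √(∑ i, π (s₀ + k) f (x i) ^ 2) ≤ R)
    (hR' : ∀ k ≤ n, √(∑ i, π' (s₀ + k) g (x i) ^ 2) ≤ R') :
    |prodDev μ x (π (s₀ + n) f) (π' (s₀ + n) g)| ≤
      Real.exp 33 * (3 * (u * L) * (R' + √N * b') + 2 * (u * L') * (R + √N * b)) := by
  set G : ℕ → ℝ := fun k => √(u ^ 2 * 2 ^ (s₀ + k)) *
    (gradedNorm μ (u ^ 2 * 2 ^ (s₀ + k)) (π (s₀ + k + 1) f - π (s₀ + k) f)).toReal with hG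
  set G' : ℕ → ℝ := fun k => √(u ^ 2 * 2 ^ (s₀ + k)) *
    (gradedNorm μ (u ^ 2 * 2 ^ (s₀ + k)) (π' (s₀ + k + 1) g - π' (s₀ + k) g)).toReal with hG'
  have hG0 : ∀ k, 0 ≤ G k := fun k => by positivity
  have hG0' : ∀ k, 0 ≤ G' k := fun k => by positivity
  have hR0 : 0 ≤ R := (Real.sqrt_nonneg _).trans (hR 0 (Nat.zero_le _))
  have hR0' : 0 ≤ R' := (Real.sqrt_nonneg _).trans (hR' 0 (Nat.zero_le _))
  have hint : ∀ s t, Integrable (fun z => π s f z * π' t g z) μ := fun s t =>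
    (memLp_two_mul (hF.measurable _ _ (hF.mem s f hf)) (hH.measurable _ _ (hH.mem t g hg)) hb hb'
      (hF.eLpNorm_le _ _ (hF.mem s f hf)) (hH.eLpNorm_le _ _ (hH.mem t g hg))).1.integrable
      (by norm_num)
  have key : ∀ m ≤ n, |prodDev μ x (π (s₀ + m) f) (π' (s₀ + m) g)| ≤
      Real.exp 33 * ((u * L + ∑ k ∈ Finset.range m, G k) * (R' + √N * b') +
        (∑ k ∈ Finset.range m, G' k) * (R + √N * b)) := by
    intro m
    induction m with
    | zero =>
      intro _
      have h1 := h.1 _ (hF.mem s₀ f hf) _ (hH.mem s₀ g hg) (hF.start_ne_top f hf)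
      simp only [add_zero, Finset.range_zero, Finset.sum_empty, zero_mul]
      refine h1.trans ?_
      have h2 := hF.start_le f hf
      have h3 := hR' 0 (Nat.zero_le _)
      have h4 : 0 ≤ u * L := le_trans (by positivity) h2
      simp only [add_zero] at h3
      calc _ = Real.exp 33 * ((√(u ^ 2 * 2 ^ s₀) *
            (gradedNorm μ (u ^ 2 * 2 ^ s₀) (π s₀ f)).toReal) *
            (√(∑ i, π' s₀ g (x i) ^ 2) + √N * b')) := by ring
        _ ≤ _ := by gcongr
    | succ m ih =>
      intro hm
      have h0 := ih (by omega)
      -- Discrete product rule `f₁ g₁ = f₀ g₀ + (f₁ - f₀) g₁ + (g₁ - g₀) f₀`.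
      have e : prodDev μ x (π (s₀ + (m + 1)) f) (π' (s₀ + (m + 1)) g) =
          prodDev μ x (π (s₀ + m) f) (π' (s₀ + m) g) +
          prodDev μ x (π (s₀ + m + 1) f - π (s₀ + m) f) (π' (s₀ + m + 1) g) +
          prodDev μ x (π' (s₀ + m + 1) g - π' (s₀ + m) g) (π (s₀ + m) f) := by
        rw [prodDev_sub_left x (hint _ _) (hint _ _), prodDev_sub_left x, prodDev_comm x (π' _ g),
          prodDev_comm x (π' _ g)]
        · rw [← add_assoc]; ring
        · simpa only [mul_comm] using hint (s₀ + m) (s₀ + m + 1)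
        · simpa only [mul_comm] using hint (s₀ + m) (s₀ + m)
      have l1 : |prodDev μ x (π (s₀ + m + 1) f - π (s₀ + m) f) (π' (s₀ + m + 1) g)| ≤
          Real.exp 33 * (G m * (R' + √N * b')) := by
        refine (h.2 m _ (hF.mem _ f hf) _ (hF.mem _ f hf) _ (Or.inr (hH.mem _ g hg))
          (hF.incr_ne_top f hf m)).trans ?_
        rw [mul_assoc (Real.exp 33), mul_assoc (Real.exp 33)]
        have h3 := hR' (m + 1) hm
        rw [← add_assoc] at h3
        gcongr
      have l2 : |prodDev μ x (π' (s₀ + m + 1) g - π' (s₀ + m) g) (π (s₀ + m) f)| ≤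
          Real.exp 33 * (G' m * (R + √N * b)) := by
        refine (h'.2 m _ (hH.mem _ g hg) _ (hH.mem _ g hg) _ (Or.inl (hF.mem _ f hf))
          (hH.incr_ne_top g hg m)).trans ?_
        rw [mul_assoc (Real.exp 33), mul_assoc (Real.exp 33)]
        have h3 := hR m (by omega)
        gcongr
      rw [e, Finset.sum_range_succ, Finset.sum_range_succ]
      refine (abs_add_three _ _ _).trans ((add_le_add (add_le_add h0 l1) l2).trans
        (le_of_eq ?_))
      ring
  refine (key n le_rfl).trans ?_
  have s1 := hF.incr_le f hf n
  have s2 := hH.incr_le g hg n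
  have s3 : u * L + ∑ k ∈ Finset.range n, G k ≤ 3 * (u * L) := by linarith
  gcongr

theorem le_of_sq_le_mul_add_sq {R G β : ℝ} (hG : 0 ≤ G) (hβ : 0 ≤ β)
    (h : R ^ 2 ≤ G * (R + β) + β ^ 2) : R ≤ 2 * G + 2 * β := by
  by_contra! hcon
  nlinarith

/-- Self-bounding: with both chains equal, the deviation of the square of a chain point is `R² - N E
v²`, while the chaining bound is linear in the largest empirical norm met along the way. Solving the
quadratic inequality bounds `R`. -/
theorem sqrt_sum_sq_chain_le [IsProbabilityMeasure μ] {u : ℝ} {s₀ : ℕ}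
    {F : Set (Ω → ℝ)} {A : ℕ → Set (Ω → ℝ)} {π : ℕ → (Ω → ℝ) → (Ω → ℝ)}
    {L b : ℝ} (huL : 0 ≤ u * L) (hb : 0 < b) (hF : IsChain μ u s₀ F A π L b) {x : Fin N → Ω}
    (h : LinksHold μ u b s₀ x A A) {f : Ω → ℝ} (hf : f ∈ F) (n : ℕ) :
    √(∑ i, π (s₀ + n) f (x i) ^ 2) ≤ 10 * Real.exp 33 * (u * L) + 2 * (√N * b) := by
  -- Chain points of all functions up to level `n` form a finite set, so a maximiser exists, at some
  -- level `m ≤ n`. Its own chain up to `m` stays in the set and is dominated by it.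
  set T : Set (Ω → ℝ) := {v | ∃ f ∈ F, ∃ k ≤ n, v = π (s₀ + k) f} with hT
  have hTfin : T.Finite := by
    refine Set.Finite.subset ((Set.finite_Iic n).biUnion fun k _ => hF.finite (s₀ + k)) ?_
    rintro v ⟨f, hf, k, hk, rfl⟩
    exact Set.mem_biUnion hk (hF.mem _ f hf)
  obtain ⟨v, ⟨g, hg, m, hm, rfl⟩, hmax⟩ := Set.exists_max_image T
    (fun v => √(∑ i, v (x i) ^ 2)) hTfin ⟨_, f, hf, n, le_rfl, rfl⟩
  set R := √(∑ i, π (s₀ + m) g (x i) ^ 2) with hR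
  refine (hmax _ ⟨f, hf, n, le_rfl, rfl⟩).trans ?_
  have hb1 : ∀ k ≤ m, √(∑ i, π (s₀ + k) g (x i) ^ 2) ≤ R := fun k hk =>
    hmax _ ⟨g, hg, k, hk.trans hm, rfl⟩
  have h1 := abs_prodDev_chain_le hb hb hF hF h h hg hg m hb1 hb1
  have h2 := (le_abs_self _).trans h1
  have hgm := hF.mem (s₀ + m) g hg
  have h3 := integral_sq_le_of_eLpNorm_four_le (hF.measurable _ _ hgm) hb (hF.eLpNorm_le _ _ hgm)
  have h4 : R ^ 2 = ∑ i, π (s₀ + m) g (x i) ^ 2 :=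
    Real.sq_sqrt (Finset.sum_nonneg fun i _ => by positivity)
  have h5 : prodDev μ x (π (s₀ + m) g) (π (s₀ + m) g) =
      R ^ 2 - N * ∫ z, π (s₀ + m) g z * π (s₀ + m) g z ∂μ := by
    rw [h4, prodDev, Finset.sum_sub_distrib]
    simp [pow_two]
  have h6 : (√(N : ℝ) * b) ^ 2 = N * b ^ 2 := by
    rw [mul_pow, Real.sq_sqrt (by positivity)]
  have h7 : (N : ℝ) * ∫ z, π (s₀ + m) g z * π (s₀ + m) g z ∂μ ≤ N * b ^ 2 := by gcongr
  have h8 : R ^ 2 ≤ (5 * Real.exp 33 * (u * L)) * (R + √N * b) + (√N * b) ^ 2 := by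
    rw [h5] at h2
    rw [h6]
    linarith
  have := le_of_sq_le_mul_add_sq (by positivity) (by positivity) h8
  linarith

theorem abs_prodDev_chain_le_of_linksHold [IsProbabilityMeasure μ] {u : ℝ} {s₀ : ℕ} (hu : 0 ≤ u)
    {F H : Set (Ω → ℝ)} {A A' : ℕ → Set (Ω → ℝ)} {π π' : ℕ → (Ω → ℝ) → (Ω → ℝ)}
    {L L' b b' : ℝ} (hL : 0 ≤ L) (hL' : 0 ≤ L') (hb : 0 < b) (hb' : 0 < b')
    (hF : IsChain μ u s₀ F A π L b) (hH : IsChain μ u s₀ H A' π' L' b') {x : Fin N → Ω}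
    (hFF : LinksHold μ u b s₀ x A A) (hHH : LinksHold μ u b' s₀ x A' A')
    (hFH : LinksHold μ u b' s₀ x A A') (hHF : LinksHold μ u b s₀ x A' A)
    {f g : Ω → ℝ} (hf : f ∈ F) (hg : g ∈ H) (n : ℕ) :
    |prodDev μ x (π (s₀ + n) f) (π' (s₀ + n) g)| ≤
      50 * Real.exp 33 ^ 2 * (u ^ 2 * L' * L + u * √N * (b * L' + b' * L)) := by
  have h1 : 1 ≤ Real.exp 33 := Real.one_le_exp (by norm_num)
  set C := Real.exp 33 with hC
  have huL : 0 ≤ u * L := by positivity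
  have huL' : 0 ≤ u * L' := by positivity
  refine (abs_prodDev_chain_le hb hb' hF hH hFH hHF hf hg n
    (fun k _ => sqrt_sum_sq_chain_le huL hb hF hFF hf k)
    (fun k _ => sqrt_sum_sq_chain_le huL' hb' hH hHH hg k)).trans ?_
  rw [← hC]
  have h2 : C ≤ C ^ 2 := by nlinarith
  have n1 : 0 ≤ u * √N * (b' * L) := by positivity
  have n2 : 0 ≤ u * √N * (b * L') := by positivity
  calc _ = C ^ 2 * (50 * (u ^ 2 * L' * L)) + C * (9 * (u * √N * (b' * L))) +
        C * (6 * (u * √N * (b * L'))) := by ring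
    _ ≤ C ^ 2 * (50 * (u ^ 2 * L' * L)) + C ^ 2 * (50 * (u * √N * (b' * L))) +
        C ^ 2 * (50 * (u * √N * (b * L'))) := by
        gcongr <;> norm_num
    _ = _ := by ring

end Chaining

/-! ### Convergence of expectations -/

section Limits

variable {Ω : Type*} [MeasurableSpace Ω] {μ : Measure Ω}

/-- Hölder's inequality: the `L₁` norm over a set `s` is at most `C * μ(s) ^ (1/2)`, hence the
choice `(ε / C) ^ 2`. -/
theorem unifIntegrable_one_of_eLpNorm_two_le [IsProbabilityMeasure μ] {Z : ℕ → Ω → ℝ} {C : ℝ}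
    (hC : 0 < C) (hZ : ∀ n, AEStronglyMeasurable (Z n) μ)
    (hle : ∀ n, eLpNorm (Z n) 2 μ ≤ ENNReal.ofReal C) : UnifIntegrable Z 1 μ := by
  intro ε hε
  refine ⟨(ε / C) ^ 2, by positivity, fun n s hs hμs => ?_⟩
  rw [eLpNorm_indicator_eq_eLpNorm_restrict hs]
  refine (eLpNorm_le_eLpNorm_mul_rpow_measure_univ (q := 2) (by norm_num) (hZ n).restrict).trans ?_
  have e : (1 / ENNReal.toReal 1 - 1 / ENNReal.toReal 2 : ℝ) = 1 / 2 := by norm_num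
  rw [e, Measure.restrict_apply_univ]
  have h1 : (μ s) ^ (1 / 2 : ℝ) ≤ ENNReal.ofReal (ε / C) := by
    refine (ENNReal.rpow_le_rpow hμs (by norm_num)).trans (le_of_eq ?_)
    rw [ENNReal.ofReal_rpow_of_pos (by positivity), ← Real.sqrt_eq_rpow,
      Real.sqrt_sq (by positivity)]
  calc _ ≤ ENNReal.ofReal C * ENNReal.ofReal (ε / C) :=
        mul_le_mul' ((eLpNorm_mono_measure _ Measure.restrict_le_self).trans (hle n)) h1
    _ = ENNReal.ofReal ε := by
        rw [← ENNReal.ofReal_mul hC.le, mul_div_cancel₀ _ hC.ne']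

theorem eLpNorm_two_mul_le [IsProbabilityMeasure μ] {U V : Ω → ℝ} (hU : Measurable U)
    (hV : Measurable V) {a b : ℝ} (ha : 0 < a) (hb : 0 < b)
    (hUa : eLpNorm U 4 μ ≤ ENNReal.ofReal a) (hVb : eLpNorm V 4 μ ≤ ENNReal.ofReal b) :
    eLpNorm (fun z => U z * V z) 2 μ ≤ ENNReal.ofReal (a * b) := by
  obtain ⟨h1, h2⟩ := memLp_two_mul hU hV ha hb hUa hVb
  rw [h1.eLpNorm_eq_integral_rpow_norm (by norm_num) (by norm_num)]
  refine ENNReal.ofReal_le_ofReal ?_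
  simp only [ENNReal.toReal_ofNat, Real.rpow_ofNat, Real.norm_eq_abs, sq_abs]
  rw [show (2 : ℝ)⁻¹ = 1 / 2 by norm_num, ← Real.sqrt_eq_rpow]
  exact Real.sqrt_le_iff.2 ⟨by positivity, h2⟩

/-- Vitali's theorem: the products converge almost everywhere and are bounded in `L₂`, hence
uniformly integrable. -/
theorem tendsto_integral_mul_of_ae [IsProbabilityMeasure μ] {f g : ℕ → Ω → ℝ} {f' g' : Ω → ℝ}
    {a b : ℝ} (ha : 0 < a) (hb : 0 < b) (hf : ∀ n, Measurable (f n)) (hg : ∀ n, Measurable (g n))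
    (hfa : ∀ n, eLpNorm (f n) 4 μ ≤ ENNReal.ofReal a)
    (hgb : ∀ n, eLpNorm (g n) 4 μ ≤ ENNReal.ofReal b)
    (hf' : Measurable f') (hg' : Measurable g')
    (hfa' : eLpNorm f' 4 μ ≤ ENNReal.ofReal a) (hgb' : eLpNorm g' 4 μ ≤ ENNReal.ofReal b)
    (hfl : ∀ᵐ z ∂μ, Filter.Tendsto (fun n => f n z) Filter.atTop (nhds (f' z)))
    (hgl : ∀ᵐ z ∂μ, Filter.Tendsto (fun n => g n z) Filter.atTop (nhds (g' z))) :
    Filter.Tendsto (fun n => ∫ z, f n z * g n z ∂μ) Filter.atTop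
      (nhds (∫ z, f' z * g' z ∂μ)) := by
  have hmem : ∀ n, MemLp (fun z => f n z * g n z) 1 μ := fun n =>
    (memLp_two_mul (hf n) (hg n) ha hb (hfa n) (hgb n)).1.mono_exponent (by norm_num)
  have hmem' : MemLp (fun z => f' z * g' z) 1 μ :=
    (memLp_two_mul hf' hg' ha hb hfa' hgb').1.mono_exponent (by norm_num)
  have hui : UnifIntegrable (fun n z => f n z * g n z) 1 μ :=
    unifIntegrable_one_of_eLpNorm_two_le (mul_pos ha hb) (fun n => (hmem n).1)
      fun n => eLpNorm_two_mul_le (hf n) (hg n) ha hb (hfa n) (hgb n)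
  refine tendsto_integral_of_L1' _ (memLp_one_iff_integrable.1 hmem').aestronglyMeasurable
    (Filter.Eventually.of_forall fun n => memLp_one_iff_integrable.1 (hmem n)) ?_
  refine tendsto_Lp_finite_of_tendsto_ae le_rfl ENNReal.one_ne_top (fun n => (hmem n).1) hmem'
    hui ?_
  filter_upwards [hfl, hgl] with z h1 h2
  exact h1.mul h2

theorem tendsto_prodDev [IsProbabilityMeasure μ] {N : ℕ} {x : Fin N → Ω} {f g : ℕ → Ω → ℝ}
    {f' g' : Ω → ℝ} (hfx : ∀ i, Filter.Tendsto (fun n => f n (x i)) Filter.atTop (nhds (f' (x i))))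
    (hgx : ∀ i, Filter.Tendsto (fun n => g n (x i)) Filter.atTop (nhds (g' (x i))))
    (hE : Filter.Tendsto (fun n => ∫ z, f n z * g n z ∂μ) Filter.atTop
      (nhds (∫ z, f' z * g' z ∂μ))) :
    Filter.Tendsto (fun n => prodDev μ x (f n) (g n)) Filter.atTop (nhds (prodDev μ x f' g')) :=
  tendsto_finsetSum _ fun i _ => ((hfx i).mul (hgx i)).sub hE

end Limits

/-! ### Chains from the complexity parameter -/

section ChainConstruction

variable {Ω : Type*} [MeasurableSpace Ω] {μ : Measure Ω} {u : ℝ} {s₀ : ℕ} {F : Set (Ω → ℝ)}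
  {A : ℕ → Set (Ω → ℝ)} {π : ℕ → (Ω → ℝ) → (Ω → ℝ)}

theorem two_rpow_half (s : ℕ) : (2 : ℝ≥0∞) ^ ((s : ℝ) / 2) = ENNReal.ofReal √(2 ^ s) := by
  rw [Real.sqrt_eq_rpow, ← Real.rpow_natCast, ← Real.rpow_mul (by norm_num),
    ← ENNReal.ofReal_rpow_of_pos (by norm_num), ENNReal.ofReal_ofNat]
  congr 1
  ring

theorem tsum_gradedNorm_le_chainSum {f : Ω → ℝ} (hf : f ∈ F) :
    ∑' k : ℕ, ENNReal.ofReal √(2 ^ (s₀ + k)) *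
      gradedNorm μ (u ^ 2 * 2 ^ (s₀ + k)) (f - π (s₀ + k) f) ≤ chainSum μ s₀ u F π := by
  refine le_trans ?_ (le_iSup₂ (f := fun f (_ : f ∈ F) => ∑' s : Set.Ici s₀,
    (2 : ℝ≥0∞) ^ (((s : ℕ) : ℝ) / 2) * gradedNorm μ (u ^ 2 * 2 ^ (s : ℕ)) (f - π s f)) f hf)
  have hinj : Function.Injective (fun k : ℕ => (⟨s₀ + k, Nat.le_add_right _ _⟩ : Set.Ici s₀)) :=
    fun k l h => Nat.add_left_cancel (congrArg Subtype.val h)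
  refine le_trans (le_of_eq (tsum_congr fun k => ?_)) (ENNReal.tsum_comp_le_tsum_of_injective hinj _)
  rw [two_rpow_half]

/-- The graded norm dominates the `L₁` norm and the weights are at least `1`, so the errors are
summable in `L₁`; hence they are summable, and tend to zero, at almost every point. -/
theorem ae_tendsto_of_tsum_gradedNorm_ne_top (hu : 1 ≤ u) {f : Ω → ℝ} (hf : Measurable f)
    (hπ : ∀ s, Measurable (π s f))
    (h : ∑' k : ℕ, ENNReal.ofReal √(2 ^ (s₀ + k)) *
      gradedNorm μ (u ^ 2 * 2 ^ (s₀ + k)) (f - π (s₀ + k) f) ≠ ∞) :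
    ∀ᵐ z ∂μ, Filter.Tendsto (fun k => π (s₀ + k) f z) Filter.atTop (nhds (f z)) := by
  have hm : ∀ k, Measurable fun z => ‖(f - π (s₀ + k) f) z‖ₑ := fun k =>
    (hf.sub (hπ _)).enorm
  have h1 : ∫⁻ z, ∑' k, ‖(f - π (s₀ + k) f) z‖ₑ ∂μ ≠ ∞ := by
    rw [lintegral_tsum fun k => (hm k).aemeasurable]
    refine ne_top_of_le_ne_top h (ENNReal.tsum_le_tsum fun k => ?_)
    have h2 : (1 : ℝ) ≤ 2 ^ (s₀ + k) := one_le_pow₀ (by norm_num)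
    have h3 := eLpNorm_le_gradedNorm (μ := μ) (f - π (s₀ + k) f) (r := 1)
      (p := u ^ 2 * 2 ^ (s₀ + k)) le_rfl (by nlinarith)
    rw [ENNReal.ofReal_one, Real.sqrt_one, ENNReal.ofReal_one, mul_one,
      eLpNorm_one_eq_lintegral_enorm] at h3
    refine h3.trans ?_
    have h4 : 1 ≤ ENNReal.ofReal √(2 ^ (s₀ + k)) := by
      rw [ENNReal.one_le_ofReal]
      exact Real.one_le_sqrt.2 h2
    calc _ = 1 * gradedNorm μ (u ^ 2 * 2 ^ (s₀ + k)) (f - π (s₀ + k) f) := (one_mul _).symm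
      _ ≤ _ := by gcongr
  have h5 := ae_lt_top (Measurable.tsum hm) h1
  filter_upwards [h5] with z hz
  have h6 := ENNReal.tendsto_atTop_zero_of_tsum_ne_top hz.ne
  rw [tendsto_iff_edist_tendsto_0]
  refine h6.congr fun k => ?_
  rw [edist_comm, edist_eq_enorm_sub]
  rfl

/-- An increment is compared with the two errors `f - π_s f` and `f - π_{s+1} f`. The second may be
measured in the larger norm of level `s + 1` with its larger weight, so each error is counted at
most twice; this is the factor `2` in `incr_le`. -/
theorem isChain_of_chainSum_add_chainStart_le [IsProbabilityMeasure μ] (hu : 0 ≤ u)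
    (hFm : ∀ f ∈ F, Measurable f) (hA : IsAdmissible F A) (hπ : IsNearestPointMap μ u F A π)
    {L b : ℝ} (hL : 0 ≤ L) (hle : chainSum μ s₀ u F π + chainStart μ s₀ u F π ≤ ENNReal.ofReal L)
    (hb : ∀ f ∈ F, eLpNorm f 4 μ ≤ ENNReal.ofReal b) : IsChain μ u s₀ F A π L b := by
  have hsqrt : ∀ s : ℕ, √(u ^ 2 * 2 ^ s) = u * √(2 ^ s) := fun s => by
    rw [Real.sqrt_mul (by positivity), Real.sqrt_sq hu]
  have hAm : ∀ s, ∀ f ∈ A s, Measurable f := fun s f hf => hFm f (hA.subset s hf)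
  have hmem : ∀ s, ∀ f ∈ F, π s f ∈ A s := fun s f hf => (hπ s f hf).1
  have hpos : ∀ s : ℕ, 0 < √((2 : ℝ) ^ s) := fun s => Real.sqrt_pos.2 (by positivity)
  have hstart : ∀ f ∈ F, ENNReal.ofReal √(2 ^ s₀) * gradedNorm μ (u ^ 2 * 2 ^ s₀) (π s₀ f) ≤
      ENNReal.ofReal L := fun f hf => by
    refine le_trans ?_ (le_trans le_add_self hle)
    rw [chainStart, two_rpow_half]
    gcongr
    exact le_iSup₂ (f := fun f (_ : f ∈ F) => gradedNorm μ (u ^ 2 * 2 ^ s₀) (π s₀ f)) f hf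
  set α : (Ω → ℝ) → ℕ → ℝ≥0∞ := fun f k => ENNReal.ofReal √(2 ^ (s₀ + k)) *
    gradedNorm μ (u ^ 2 * 2 ^ (s₀ + k)) (f - π (s₀ + k) f) with hα
  have hαle : ∀ f ∈ F, ∑' k, α f k ≤ ENNReal.ofReal L := fun f hf =>
    (tsum_gradedNorm_le_chainSum hf).trans (le_trans le_self_add hle)
  have hstep : ∀ f ∈ F, ∀ k, ENNReal.ofReal √(2 ^ (s₀ + k)) *
      gradedNorm μ (u ^ 2 * 2 ^ (s₀ + k)) (π (s₀ + k + 1) f - π (s₀ + k) f) ≤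
      α f k + α f (k + 1) := fun f hf k => by
    have h1 := gradedNorm_sub_le (μ := μ) (hAm _ _ (hmem (s₀ + k) f hf))
      (hAm _ _ (hmem (s₀ + k + 1) f hf)) (hFm f hf) (u ^ 2 * 2 ^ (s₀ + k))
    have h2 : (2 : ℝ) ^ (s₀ + k) ≤ 2 ^ (s₀ + k + 1) := pow_le_pow_right₀ (by norm_num) (by omega)
    calc _ ≤ ENNReal.ofReal √(2 ^ (s₀ + k)) *
          (gradedNorm μ (u ^ 2 * 2 ^ (s₀ + k)) (f - π (s₀ + k) f) +
            gradedNorm μ (u ^ 2 * 2 ^ (s₀ + k)) (f - π (s₀ + k + 1) f)) := by gcongr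
      _ ≤ ENNReal.ofReal √(2 ^ (s₀ + k)) * gradedNorm μ (u ^ 2 * 2 ^ (s₀ + k)) (f - π (s₀ + k) f) +
          ENNReal.ofReal √(2 ^ (s₀ + k + 1)) *
            gradedNorm μ (u ^ 2 * 2 ^ (s₀ + k + 1)) (f - π (s₀ + k + 1) f) := by
          rw [mul_add]
          gcongr
          exact gradedNorm_mono _ (by gcongr)
      _ = _ := rfl
  have hincr : ∀ f ∈ F, ∀ n, ∑ k ∈ Finset.range n, ENNReal.ofReal √(2 ^ (s₀ + k)) *
      gradedNorm μ (u ^ 2 * 2 ^ (s₀ + k)) (π (s₀ + k + 1) f - π (s₀ + k) f) ≤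
      ENNReal.ofReal (2 * L) := fun f hf n => by
    refine (Finset.sum_le_sum fun k _ => hstep f hf k).trans ?_
    rw [Finset.sum_add_distrib, two_mul, ENNReal.ofReal_add hL hL]
    refine add_le_add ((ENNReal.sum_le_tsum _).trans (hαle f hf))
      (le_trans ?_ (hαle f hf))
    exact (ENNReal.sum_le_tsum _).trans
      (ENNReal.tsum_comp_le_tsum_of_injective (add_left_injective 1) (α f))
  have hfin : ∀ (s : ℕ) {G B : ℝ≥0∞}, ENNReal.ofReal √(2 ^ s) * G ≤ B → B ≠ ∞ → G ≠ ∞ := by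
    intro s G B h hB hG
    rw [hG, ENNReal.mul_top (by simp), top_le_iff] at h
    exact hB h
  have hincr_fin : ∀ f ∈ F, ∀ k,
      gradedNorm μ (u ^ 2 * 2 ^ (s₀ + k)) (π (s₀ + k + 1) f - π (s₀ + k) f) ≠ ∞ := fun f hf k =>
    hfin (s₀ + k) ((Finset.single_le_sum (fun _ _ => zero_le)
      (Finset.self_mem_range_succ k)).trans (hincr f hf (k + 1))) ENNReal.ofReal_ne_top
  refine ⟨hAm, fun s => Set.finite_of_encard_le_coe (hA.encard_le s), hmem,
    fun s v hv => hb v (hA.subset s hv),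
    fun f hf => hfin s₀ (hstart f hf) ENNReal.ofReal_ne_top, fun f hf => ?_, hincr_fin,
    fun f hf n => ?_⟩
  · have h1 := ENNReal.toReal_mono ENNReal.ofReal_ne_top (hstart f hf)
    rw [ENNReal.toReal_mul, ENNReal.toReal_ofReal (by positivity), ENNReal.toReal_ofReal hL] at h1
    rw [hsqrt, mul_assoc]
    gcongr
  · have h1 := ENNReal.toReal_mono ENNReal.ofReal_ne_top (hincr f hf n)
    rw [ENNReal.toReal_sum fun k _ => ENNReal.mul_ne_top ENNReal.ofReal_ne_top (hincr_fin f hf k),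
      ENNReal.toReal_ofReal (by positivity)] at h1
    simp only [ENNReal.toReal_mul] at h1
    calc _ = u * ∑ k ∈ Finset.range n, (ENNReal.ofReal √(2 ^ (s₀ + k))).toReal *
          (gradedNorm μ (u ^ 2 * 2 ^ (s₀ + k)) (π (s₀ + k + 1) f - π (s₀ + k) f)).toReal := by
          rw [Finset.mul_sum]
          refine Finset.sum_congr rfl fun k _ => ?_
          rw [hsqrt, ENNReal.toReal_ofReal (by positivity), mul_assoc]
      _ ≤ u * (2 * L) := by gcongr
      _ = _ := by ring

/-- Near-optimal chains exist as soon as the complexity parameter is finite and positive. -/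
theorem exists_chain_of_lambdaTilde [IsProbabilityMeasure μ] (hu : 1 ≤ u)
    (hFm : ∀ f ∈ F, Measurable f) (h0 : LambdaTilde μ s₀ u F ≠ 0) (htop : LambdaTilde μ s₀ u F ≠ ∞)
    {b : ℝ} (hb : ∀ f ∈ F, eLpNorm f 4 μ ≤ ENNReal.ofReal b) :
    ∃ (A : ℕ → Set (Ω → ℝ)) (π : ℕ → (Ω → ℝ) → (Ω → ℝ)), IsAdmissible F A ∧
      IsChain μ u s₀ F A π (2 * (LambdaTilde μ s₀ u F).toReal) b ∧
      ∀ f ∈ F, ∀ᵐ z ∂μ, Filter.Tendsto (fun k => π (s₀ + k) f z) Filter.atTop (nhds (f z)) := by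
  -- The infimum need not be attained; positivity and finiteness allow a choice within a factor `2`.
  have hlt : LambdaTilde μ s₀ u F < 2 * LambdaTilde μ s₀ u F := by
    rw [two_mul]
    exact ENNReal.lt_add_right htop h0
  obtain ⟨A, hlt⟩ := iInf_lt_iff.1 hlt
  obtain ⟨π, hlt⟩ := iInf_lt_iff.1 hlt
  obtain ⟨⟨hA, hπ⟩, hlt⟩ := iInf_lt_iff.1 hlt
  have hle : chainSum μ s₀ u F π + chainStart μ s₀ u F π ≤
      ENNReal.ofReal (2 * (LambdaTilde μ s₀ u F).toReal) := by
    rw [ENNReal.ofReal_mul (by norm_num), ENNReal.ofReal_toReal htop, ENNReal.ofReal_ofNat]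
    exact hlt.le
  refine ⟨A, π, hA, isChain_of_chainSum_add_chainStart_le (by linarith) hFm hA hπ
    (by positivity) hle hb, fun f hf => ?_⟩
  refine ae_tendsto_of_tsum_gradedNorm_ne_top hu (hFm f hf)
    (fun s => hFm _ (hA.subset s (hπ s f hf).1)) ?_
  exact ne_top_of_le_ne_top ENNReal.ofReal_ne_top
    ((tsum_gradedNorm_le_chainSum hf).trans (le_trans le_self_add hle))

end ChainConstruction

/-! ### From chains to whole classes -/

section ProductBound

variable {Ω : Type*} [MeasurableSpace Ω] {μ : Measure Ω}

/-- Since `q ≤ u² 2 ^ s₀`, the graded norm at the starting level controls `L_q`, and `f = (f -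
π_{s₀} f) + π_{s₀} f` splits it into a term of the chaining sum and the starting term. Thus a finite
complexity forces a finite radius, and a nonzero radius forces a nonzero complexity. -/
theorem radius_le_sqrt_mul_lambdaTilde {q u : ℝ} (hq : 1 ≤ q) (hqu : q ≤ u ^ 2) (s₀ : ℕ)
    {F : Set (Ω → ℝ)} (hFm : ∀ f ∈ F, Measurable f) :
    radius μ q F ≤ ENNReal.ofReal √q * LambdaTilde μ s₀ u F := by
  have hq0 : ENNReal.ofReal √q ≠ 0 := by
    simp only [ne_eq, ENNReal.ofReal_eq_zero, not_le]
    exact Real.sqrt_pos.2 (by linarith)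
  rw [mul_comm, ← ENNReal.div_le_iff hq0 ENNReal.ofReal_ne_top]
  refine le_iInf fun A => le_iInf fun π => le_iInf fun h => ?_
  rw [ENNReal.div_le_iff hq0 ENNReal.ofReal_ne_top]
  refine iSup₂_le fun f hf => ?_
  have h1 : (1 : ℝ) ≤ 2 ^ s₀ := one_le_pow₀ (by norm_num)
  have hπ : π s₀ f ∈ F := h.1.subset s₀ (h.2 s₀ f hf).1
  have h2 := eLpNorm_le_gradedNorm (μ := μ) f hq (p := u ^ 2 * 2 ^ s₀) (by nlinarith)
  refine h2.trans ?_
  gcongr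
  have h3 := gradedNorm_add_le (μ := μ) ((hFm f hf).sub (hFm _ hπ)) (hFm _ hπ) (u ^ 2 * 2 ^ s₀)
  rw [sub_add_cancel] at h3
  refine h3.trans ?_
  have h4 : 1 ≤ ENNReal.ofReal √(2 ^ s₀) := by
    rw [ENNReal.one_le_ofReal]
    exact Real.one_le_sqrt.2 h1
  have h5 : gradedNorm μ (u ^ 2 * 2 ^ s₀) (f - π s₀ f) ≤ chainSum μ s₀ u F π := by
    refine le_trans ?_ (tsum_gradedNorm_le_chainSum hf)
    refine le_trans ?_ (ENNReal.le_tsum 0)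
    rw [add_zero]
    calc _ = 1 * gradedNorm μ (u ^ 2 * 2 ^ s₀) (f - π s₀ f) := (one_mul _).symm
      _ ≤ _ := by gcongr
  have h6 : gradedNorm μ (u ^ 2 * 2 ^ s₀) (π s₀ f) ≤ chainStart μ s₀ u F π := by
    rw [chainStart, two_rpow_half]
    calc _ = 1 * gradedNorm μ (u ^ 2 * 2 ^ s₀) (π s₀ f) := (one_mul _).symm
      _ ≤ _ := by
        gcongr
        exact le_iSup₂ (f := fun f (_ : f ∈ F) => gradedNorm μ (u ^ 2 * 2 ^ s₀) (π s₀ f)) f hf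
  exact add_le_add h5 h6

theorem eLpNorm_le_radius (q : ℝ) {F : Set (Ω → ℝ)} {f : Ω → ℝ} (hf : f ∈ F) :
    eLpNorm f (ENNReal.ofReal q) μ ≤ radius μ q F :=
  le_iSup₂ (f := fun f (_ : f ∈ F) => eLpNorm f (ENNReal.ofReal q) μ) f hf

theorem ae_eq_zero_of_radius_eq_zero {q : ℝ} (hq : 0 < q) {F : Set (Ω → ℝ)}
    (hFm : ∀ f ∈ F, Measurable f) (h0 : radius μ q F = 0) {f : Ω → ℝ} (hf : f ∈ F) :
    f =ᵐ[μ] 0 :=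
  (eLpNorm_eq_zero_iff (hFm f hf).aestronglyMeasurable (by simpa using hq)).1
    (le_antisymm ((eLpNorm_le_radius q hf).trans h0.le) zero_le)

theorem ae_forall_eq_zero_of_radius_eq_zero {q : ℝ} (hq : 0 < q) {F : Set (Ω → ℝ)}
    (hFm : ∀ f ∈ F, Measurable f) (hF : IsSeparableClass μ F) (h0 : radius μ q F = 0) :
    ∀ᵐ z ∂μ, ∀ f ∈ F, f z = 0 := by
  obtain ⟨F₀, hsub, hcount, S, hS, hlim⟩ := hF
  have h1 : ∀ᵐ z ∂μ, ∀ f ∈ F₀, f z = 0 := (ae_ball_iff hcount).2 fun f hf =>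
    ae_eq_zero_of_radius_eq_zero hq hFm h0 (hsub hf)
  have h2 : ∀ᵐ z ∂μ, z ∉ S := measure_eq_zero_iff_ae_notMem.1 hS
  filter_upwards [h1, h2] with z hz hzS f hf
  obtain ⟨g, hg, hgl⟩ := hlim f hf
  have h3 := hgl z hzS
  simp only [hz _ (hg _)] at h3
  exact tendsto_nhds_unique h3 tendsto_const_nhds

variable {Ω' : Type*} [MeasurableSpace Ω'] {P : Measure Ω'}

/-- The bad event involves uncountably many functions and need not be measurable; the complement of
its measurable hull serves as the good event. -/
theorem exists_measurableSet_of_measure_not_le [IsProbabilityMeasure P] {p : Ω' → Prop} {ε : ℝ}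
    (hε : 0 ≤ ε) (h : P {ω | ¬ p ω} ≤ ENNReal.ofReal ε) :
    ∃ E : Set Ω', MeasurableSet E ∧ ENNReal.ofReal (1 - ε) ≤ P E ∧ ∀ ω ∈ E, p ω := by
  refine ⟨(toMeasurable P {ω | ¬ p ω})ᶜ, (measurableSet_toMeasurable _ _).compl, ?_,
    fun ω hω => ?_⟩
  · rw [prob_compl_eq_one_sub (measurableSet_toMeasurable _ _), measure_toMeasurable,
      ENNReal.ofReal_sub _ hε, ENNReal.ofReal_one]
    exact tsub_le_tsub_left h 1
  · by_contra hcon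
    exact hω (subset_toMeasurable P _ hcon)

/-- Passing to the limit along the chains and along approximating sequences in dense subclasses. -/
theorem abs_prodDev_le_of_separable [IsProbabilityMeasure μ] {N : ℕ} {x : Fin N → Ω} {s₀ : ℕ}
    {F F₀ H H₀ : Set (Ω → ℝ)} {S T : Set Ω}
    {π π' : ℕ → (Ω → ℝ) → (Ω → ℝ)} {a b K : ℝ} (ha : 0 < a) (hb : 0 < b)
    (hFm : ∀ f ∈ F, Measurable f) (hHm : ∀ h ∈ H, Measurable h)
    (hFa : ∀ f ∈ F, eLpNorm f 4 μ ≤ ENNReal.ofReal a)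
    (hHb : ∀ h ∈ H, eLpNorm h 4 μ ≤ ENNReal.ofReal b)
    (hπF : ∀ s, ∀ f ∈ F, π s f ∈ F) (hπH : ∀ s, ∀ h ∈ H, π' s h ∈ H)
    (hF₀ : F₀ ⊆ F) (hH₀ : H₀ ⊆ H) (hS : μ S = 0) (hT : μ T = 0)
    (hlimF : ∀ f ∈ F, ∃ g : ℕ → Ω → ℝ, (∀ n, g n ∈ F₀) ∧
      ∀ z ∉ S, Filter.Tendsto (fun n => g n z) Filter.atTop (nhds (f z)))
    (hlimH : ∀ f ∈ H, ∃ g : ℕ → Ω → ℝ, (∀ n, g n ∈ H₀) ∧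
      ∀ z ∉ T, Filter.Tendsto (fun n => g n z) Filter.atTop (nhds (f z)))
    (haeF : ∀ f ∈ F, ∀ᵐ z ∂μ, Filter.Tendsto (fun k => π (s₀ + k) f z) Filter.atTop (nhds (f z)))
    (haeH : ∀ h ∈ H, ∀ᵐ z ∂μ, Filter.Tendsto (fun k => π' (s₀ + k) h z) Filter.atTop (nhds (h z)))
    (hxF : ∀ i, ∀ f ∈ F₀,
      Filter.Tendsto (fun k => π (s₀ + k) f (x i)) Filter.atTop (nhds (f (x i))))
    (hxH : ∀ i, ∀ h ∈ H₀,
      Filter.Tendsto (fun k => π' (s₀ + k) h (x i)) Filter.atTop (nhds (h (x i))))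
    (hxS : ∀ i, x i ∉ S) (hxT : ∀ i, x i ∉ T)
    (hK : ∀ f ∈ F, ∀ h ∈ H, ∀ n, |prodDev μ x (π (s₀ + n) f) (π' (s₀ + n) h)| ≤ K)
    {f h : Ω → ℝ} (hf : f ∈ F) (hh : h ∈ H) : |prodDev μ x f h| ≤ K := by
  -- Chain convergence at the sample points is available only on the countable subclasses, so these
  -- come first; the approximating sequences then reach all of `F` and `H`.
  have h1 : ∀ f ∈ F₀, ∀ h ∈ H₀, |prodDev μ x f h| ≤ K := fun f hf h hh => by
    have hE := tendsto_integral_mul_of_ae ha hb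
      (fun n => hFm _ (hπF (s₀ + n) f (hF₀ hf))) (fun n => hHm _ (hπH (s₀ + n) h (hH₀ hh)))
      (fun n => hFa _ (hπF (s₀ + n) f (hF₀ hf))) (fun n => hHb _ (hπH (s₀ + n) h (hH₀ hh)))
      (hFm f (hF₀ hf)) (hHm h (hH₀ hh)) (hFa f (hF₀ hf)) (hHb h (hH₀ hh))
      (haeF f (hF₀ hf)) (haeH h (hH₀ hh))
    exact le_of_tendsto (tendsto_prodDev (fun i => hxF i f hf) (fun i => hxH i h hh) hE).abs
      (Filter.Eventually.of_forall fun n => hK f (hF₀ hf) h (hH₀ hh) n)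
  obtain ⟨g, hg, hgl⟩ := hlimF f hf
  obtain ⟨k, hk, hkl⟩ := hlimH h hh
  have hE := tendsto_integral_mul_of_ae ha hb
    (fun n => hFm _ (hF₀ (hg n))) (fun n => hHm _ (hH₀ (hk n)))
    (fun n => hFa _ (hF₀ (hg n))) (fun n => hHb _ (hH₀ (hk n)))
    (hFm f hf) (hHm h hh) (hFa f hf) (hHb h hh)
    ((measure_eq_zero_iff_ae_notMem.1 hS).mono hgl) ((measure_eq_zero_iff_ae_notMem.1 hT).mono hkl)
  exact le_of_tendsto (tendsto_prodDev (fun i => hgl _ (hxS i)) (fun i => hkl _ (hxT i)) hE).abs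
    (Filter.Eventually.of_forall fun n => h1 _ (hg n) _ (hk n))

variable {N : ℕ} {X : Fin N → Ω' → Ω}

/-- Four families of links are needed: each class against itself for the empirical norms, and each
against the other for the product. Each fails with probability at most `exp (-(u² 2 ^ s₀)) / 2`. -/
theorem measure_not_prodDev_bound_le [IsProbabilityMeasure μ]
    (hX : ∀ i, MeasurePreserving (X i) P μ) (hind : iIndepFun X P) (hN : N ≠ 0)
    {u : ℝ} (hu : 8 ≤ u) (s₀ : ℕ) {F H : Set (Ω → ℝ)}
    (hFm : ∀ f ∈ F, Measurable f) (hHm : ∀ h ∈ H, Measurable h)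
    (hF : IsSeparableClass μ F) (hH : IsSeparableClass μ H)
    (hF0 : LambdaTilde μ s₀ u F ≠ 0) (hFtop : LambdaTilde μ s₀ u F ≠ ∞)
    (hH0 : LambdaTilde μ s₀ u H ≠ 0) (hHtop : LambdaTilde μ s₀ u H ≠ ∞)
    {a b : ℝ} (ha : 0 < a) (hb : 0 < b)
    (hFa : ∀ f ∈ F, eLpNorm f 4 μ ≤ ENNReal.ofReal a)
    (hHb : ∀ h ∈ H, eLpNorm h 4 μ ≤ ENNReal.ofReal b) :
    P {ω | ¬ ∀ f ∈ F, ∀ h ∈ H, |prodDev μ (fun i => X i ω) f h| ≤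
      200 * Real.exp 33 ^ 2 *
        (u ^ 2 * (LambdaTilde μ s₀ u H).toReal * (LambdaTilde μ s₀ u F).toReal +
          u * √N * (a * (LambdaTilde μ s₀ u H).toReal + b * (LambdaTilde μ s₀ u F).toReal))} ≤
      ENNReal.ofReal (2 * Real.exp (-(u ^ 2 * 2 ^ s₀))) := by
  obtain ⟨A, π, hA, hcF, haeF⟩ := exists_chain_of_lambdaTilde (by linarith) hFm hF0 hFtop hFa
  obtain ⟨A', π', hA', hcH, haeH⟩ := exists_chain_of_lambdaTilde (by linarith) hHm hH0 hHtop hHb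
  obtain ⟨F₀, hF₀, hF₀c, S, hS, hlimF⟩ := hF
  obtain ⟨H₀, hH₀, hH₀c, T, hT, hlimH⟩ := hH
  set Reg : Ω → Prop := fun z =>
    ((∀ f ∈ F₀, Filter.Tendsto (fun k => π (s₀ + k) f z) Filter.atTop (nhds (f z))) ∧
      (∀ h ∈ H₀, Filter.Tendsto (fun k => π' (s₀ + k) h z) Filter.atTop (nhds (h z)))) ∧
      z ∉ S ∧ z ∉ T with hReg
  have hreg : ∀ᵐ z ∂μ, Reg z :=
    (((ae_ball_iff hF₀c).2 fun f hf => haeF f (hF₀ hf)).and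
      ((ae_ball_iff hH₀c).2 fun h hh => haeH h (hH₀ hh))).and
      ((measure_eq_zero_iff_ae_notMem.1 hS).and (measure_eq_zero_iff_ae_notMem.1 hT))
  have hregP : P {ω | ¬ ∀ i, Reg (X i ω)} = 0 :=
    ae_iff.1 (ae_all_iff.2 fun i => (hX i).quasiMeasurePreserving.ae hreg)
  have l1 := measure_not_linksHold_le hX hind hN hu ha s₀ hA hA hcF.measurable hcF.measurable
    hcF.eLpNorm_le
  have l2 := measure_not_linksHold_le hX hind hN hu hb s₀ hA' hA' hcH.measurable hcH.measurable
    hcH.eLpNorm_le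
  have l3 := measure_not_linksHold_le hX hind hN hu hb s₀ hA hA' hcF.measurable hcH.measurable
    hcH.eLpNorm_le
  have l4 := measure_not_linksHold_le hX hind hN hu ha s₀ hA' hA hcH.measurable hcF.measurable
    hcF.eLpNorm_le
  set ε := Real.exp (-(u ^ 2 * 2 ^ s₀)) with hε
  have hε0 : 0 < ε := Real.exp_pos _
  have hsum : ENNReal.ofReal (2 * ε) = 0 + ENNReal.ofReal (1 / 2 * ε) + ENNReal.ofReal (1 / 2 * ε) +
      ENNReal.ofReal (1 / 2 * ε) + ENNReal.ofReal (1 / 2 * ε) := by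
    rw [zero_add, ← ENNReal.ofReal_add (by positivity) (by positivity),
      ← ENNReal.ofReal_add (by positivity) (by positivity),
      ← ENNReal.ofReal_add (by positivity) (by positivity)]
    congr 1
    ring
  rw [hsum]
  refine le_trans (measure_mono (t := (((({ω | ¬ ∀ i, Reg (X i ω)} ∪
      {ω | ¬ LinksHold μ u a s₀ (fun i => X i ω) A A}) ∪
      {ω | ¬ LinksHold μ u b s₀ (fun i => X i ω) A' A'}) ∪
      {ω | ¬ LinksHold μ u b s₀ (fun i => X i ω) A A'}) ∪
      {ω | ¬ LinksHold μ u a s₀ (fun i => X i ω) A' A})) fun ω hω => ?_)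
    ((measure_union_le _ _).trans (add_le_add ((measure_union_le _ _).trans (add_le_add
      ((measure_union_le _ _).trans (add_le_add ((measure_union_le _ _).trans
        (add_le_add hregP.le l1)) l2)) l3)) l4))
  by_contra hcon
  simp only [Set.mem_union, Set.mem_ofPred_eq, not_or, not_not] at hcon
  obtain ⟨⟨⟨⟨hr, k1⟩, k2⟩, k3⟩, k4⟩ := hcon
  refine hω fun f hf h hh => ?_
  refine abs_prodDev_le_of_separable ha hb hFm hHm hFa hHb
    (fun s f hf => hA.subset s (hcF.mem s f hf)) (fun s h hh => hA'.subset s (hcH.mem s h hh))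
    hF₀ hH₀ hS hT hlimF hlimH haeF haeH (fun i => (hr i).1.1) (fun i => (hr i).1.2)
    (fun i => (hr i).2.1) (fun i => (hr i).2.2) (fun f hf h hh n => ?_) hf hh
  refine (abs_prodDev_chain_le_of_linksHold (by linarith) (by positivity) (by positivity) ha hb hcF hcH k1 k2
    k3 k4 hf hh n).trans ?_
  -- Both chains have `L` equal to twice the complexity: `50` becomes `200` in the quadratic term
  -- and `100` in the linear ones.
  set LF := (LambdaTilde μ s₀ u F).toReal
  set LH := (LambdaTilde μ s₀ u H).toReal
  have n1 : 0 ≤ u * √N * (a * LH + b * LF) := by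
    have : 0 ≤ u := by linarith
    positivity
  calc _ = Real.exp 33 ^ 2 * (200 * (u ^ 2 * LH * LF) + 100 * (u * √N * (a * LH + b * LF))) := by
        ring
    _ ≤ Real.exp 33 ^ 2 * (200 * (u ^ 2 * LH * LF) + 200 * (u * √N * (a * LH + b * LF))) := by
        gcongr
        norm_num
    _ = _ := by ring

theorem exists_event_prodDev_bound [IsProbabilityMeasure μ] [IsProbabilityMeasure P]
    (hX : ∀ i, MeasurePreserving (X i) P μ) (hind : iIndepFun X P)
    {q u : ℝ} (hq : 4 < q) (hqu : q ≤ u ^ 2) (hu : 8 ≤ u) (s₀ : ℕ) {F H : Set (Ω → ℝ)}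
    (hFm : ∀ f ∈ F, Measurable f) (hHm : ∀ h ∈ H, Measurable h)
    (hF : IsSeparableClass μ F) (hH : IsSeparableClass μ H) :
    ∃ E : Set Ω', MeasurableSet E ∧
      ENNReal.ofReal (1 - 2 * Real.exp (-(u ^ 2 * 2 ^ s₀))) ≤ P E ∧
      ∀ ω ∈ E, ∀ f ∈ F, ∀ h ∈ H,
        ENNReal.ofReal |prodDev μ (fun i => X i ω) f h| ≤
          ENNReal.ofReal (200 * Real.exp 33 ^ 2) *
            (ENNReal.ofReal (u ^ 2) * LambdaTilde μ s₀ u H * LambdaTilde μ s₀ u F +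
              ENNReal.ofReal (u * √(N : ℝ)) *
                (radius μ q F * LambdaTilde μ s₀ u H + radius μ q H * LambdaTilde μ s₀ u F)) := by
  have hu0 : 0 < u := by linarith
  refine exists_measurableSet_of_measure_not_le (by positivity) ?_
  have hzero : ∀ {Q : Ω' → Prop} {ε : ℝ≥0∞}, (∀ᵐ ω ∂P, Q ω) → P {ω | ¬ Q ω} ≤ ε :=
    fun h => (ae_iff.1 h).le.trans zero_le
  have hvanish : ∀ {G : Set (Ω → ℝ)}, (∀ f ∈ G, Measurable f) → IsSeparableClass μ G →
      radius μ q G = 0 → ∀ᵐ ω ∂P, ∀ i, ∀ f ∈ G, f (X i ω) = 0 := fun hGm hG h0 =>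
    ae_all_iff.2 fun i => (hX i).quasiMeasurePreserving.ae
      (ae_forall_eq_zero_of_radius_eq_zero (by linarith) hGm hG h0)
  by_cases hN : N = 0
  · subst hN
    refine hzero (ae_of_all _ fun ω f _ h _ => ?_)
    simp [prodDev]
  -- Degenerate radii come first. Separability makes all functions of the class vanish at the sample
  -- almost surely, so the left side is zero. Afterwards both complexities are nonzero, so an
  -- infinite one makes the right side infinite despite the convention `0 * ∞ = 0`.
  by_cases hrF : radius μ q F = 0
  · refine hzero ((hvanish hFm hF hrF).mono fun ω hω f hf h _ => ?_)
    have hI : ∫ z, f z * h z ∂μ = 0 := by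
      rw [integral_congr_ae (g := fun _ => (0 : ℝ)), integral_zero]
      filter_upwards [ae_eq_zero_of_radius_eq_zero (by linarith) hFm hrF hf] with z hz
      simp [hz]
    simp [prodDev, hI, hω _ f hf]
  by_cases hrH : radius μ q H = 0
  · refine hzero ((hvanish hHm hH hrH).mono fun ω hω f _ h hh => ?_)
    have hI : ∫ z, f z * h z ∂μ = 0 := by
      rw [integral_congr_ae (g := fun _ => (0 : ℝ)), integral_zero]
      filter_upwards [ae_eq_zero_of_radius_eq_zero (by linarith) hHm hrH hh] with z hz
      simp [hz]
    simp [prodDev, hI, hω _ h hh]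
  have hle : ∀ {G : Set (Ω → ℝ)}, (∀ f ∈ G, Measurable f) →
      radius μ q G ≤ ENNReal.ofReal √q * LambdaTilde μ s₀ u G := fun hGm =>
    radius_le_sqrt_mul_lambdaTilde (by linarith) hqu s₀ hGm
  have hne : ∀ {G : Set (Ω → ℝ)}, (∀ f ∈ G, Measurable f) → radius μ q G ≠ 0 →
      LambdaTilde μ s₀ u G ≠ 0 := fun hGm h0 hL => by
    have := hle hGm
    rw [hL, mul_zero] at this
    exact h0 (le_antisymm this zero_le)
  have hLF := hne hFm hrF
  have hLH := hne hHm hrH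
  have hu2 : ENNReal.ofReal (u ^ 2) ≠ 0 := by simpa using by positivity
  have hC : ENNReal.ofReal (200 * Real.exp 33 ^ 2) ≠ 0 := by
    simp
  by_cases hFtop : LambdaTilde μ s₀ u F = ∞
  · refine hzero (ae_of_all _ fun ω f _ h _ => ?_)
    rw [hFtop, ENNReal.mul_top (mul_ne_zero hu2 hLH), top_add, ENNReal.mul_top hC]
    exact le_top
  by_cases hHtop : LambdaTilde μ s₀ u H = ∞
  · refine hzero (ae_of_all _ fun ω f _ h _ => ?_)
    rw [hHtop, ENNReal.mul_top hu2, ENNReal.top_mul hLF, top_add, ENNReal.mul_top hC]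
    exact le_top
  have hfin : ∀ {G : Set (Ω → ℝ)}, (∀ f ∈ G, Measurable f) → LambdaTilde μ s₀ u G ≠ ∞ →
      radius μ q G ≠ ∞ := fun hGm h =>
    ne_top_of_le_ne_top (ENNReal.mul_ne_top ENNReal.ofReal_ne_top h) (hle hGm)
  have hrF' := hfin hFm hFtop
  have hrH' := hfin hHm hHtop
  have hfour : ∀ {G : Set (Ω → ℝ)}, (∀ f ∈ G, Measurable f) → radius μ q G ≠ ∞ → ∀ f ∈ G,
      eLpNorm f 4 μ ≤ ENNReal.ofReal (radius μ q G).toReal := fun hGm h f hf => by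
    rw [ENNReal.ofReal_toReal h]
    refine (eLpNorm_le_eLpNorm_of_exponent_le ?_ (hGm f hf).aestronglyMeasurable).trans
      (eLpNorm_le_radius q hf)
    rw [← ENNReal.ofReal_ofNat 4]
    exact ENNReal.ofReal_le_ofReal hq.le
  refine le_trans (measure_mono fun ω hω => ?_) (measure_not_prodDev_bound_le hX hind hN hu s₀
    hFm hHm hF hH hLF hFtop hLH hHtop (ENNReal.toReal_pos hrF hrF') (ENNReal.toReal_pos hrH hrH')
    (hfour hFm hrF') (hfour hHm hrH'))
  refine fun hgood => hω fun f hf h hh => ?_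
  refine (ENNReal.ofReal_le_ofReal (hgood f hf h hh)).trans (le_of_eq ?_)
  rw [ENNReal.ofReal_mul (p := 200 * Real.exp 33 ^ 2) (by positivity),
    ENNReal.ofReal_add (by positivity) (by positivity),
    ENNReal.ofReal_mul (q := (LambdaTilde μ s₀ u F).toReal) (by positivity),
    ENNReal.ofReal_mul (p := u ^ 2) (by positivity),
    ENNReal.ofReal_mul (p := u * √(N : ℝ)) (by positivity),
    ENNReal.ofReal_add (by positivity) (by positivity),
    ENNReal.ofReal_mul (p := (radius μ q F).toReal) (by positivity),
    ENNReal.ofReal_mul (p := (radius μ q H).toReal) (by positivity),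
    ENNReal.ofReal_toReal hFtop, ENNReal.ofReal_toReal hHtop, ENNReal.ofReal_toReal hrF',
    ENNReal.ofReal_toReal hrH']

end ProductBound

end ProductProcess

/-! ### The main theorem -/

theorem mainTheorem1 :
    ∃ c₀ : ℝ, 0 < c₀ ∧ ∀ q : ℝ, 4 < q → ∃ c₁ : ℝ, 0 < c₁ ∧
      ∀ (Ω : Type*) [MeasurableSpace Ω] (μ : Measure Ω) [IsProbabilityMeasure μ]
        (Ω' : Type*) [MeasurableSpace Ω'] (P : Measure Ω') [IsProbabilityMeasure P]
        (N : ℕ) (X : Fin N → Ω' → Ω)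
        (_ : ∀ i, MeasurePreserving (X i) P μ) (_ : iIndepFun X P)
        (u : ℝ) (_ : max 8 (√q) ≤ u) (s₀ : ℕ),
        (∀ F H : Set (Ω → ℝ),
          (∀ f ∈ F, Measurable f) → (∀ h ∈ H, Measurable h) →
          ProductProcess.IsSeparableClass μ F → ProductProcess.IsSeparableClass μ H →
          ∃ E : Set Ω', MeasurableSet E ∧
            ENNReal.ofReal (1 - 2 * Real.exp (-(c₀ * u ^ 2 * 2 ^ s₀))) ≤ P E ∧
            ∀ ω ∈ E, ∀ f ∈ F, ∀ h ∈ H,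
              ENNReal.ofReal |∑ i, (f (X i ω) * h (X i ω) - ∫ x, f x * h x ∂μ)| ≤
                ENNReal.ofReal c₁ *
                  (ENNReal.ofReal (u ^ 2) * ProductProcess.LambdaTilde μ s₀ u H *
                      ProductProcess.LambdaTilde μ s₀ u F +
                    ENNReal.ofReal (u * √(N : ℝ)) *
                      (ProductProcess.radius μ q F * ProductProcess.LambdaTilde μ s₀ u H +
                        ProductProcess.radius μ q H * ProductProcess.LambdaTilde μ s₀ u F))) ∧
        (∀ F : Set (Ω → ℝ),
          (∀ f ∈ F, Measurable f) → ProductProcess.IsSeparableClass μ F →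
          ∃ E : Set Ω', MeasurableSet E ∧
            ENNReal.ofReal (1 - 2 * Real.exp (-(c₀ * u ^ 2 * 2 ^ s₀))) ≤ P E ∧
            ∀ ω ∈ E, ∀ f ∈ F,
              ENNReal.ofReal |∑ i, (f (X i ω) ^ 2 - ∫ x, f x ^ 2 ∂μ)| ≤
                ENNReal.ofReal c₁ *
                  (ENNReal.ofReal (u ^ 2) * ProductProcess.LambdaTilde μ s₀ u F ^ 2 +
                    ENNReal.ofReal (u * √(N : ℝ)) *
                      (ProductProcess.radius μ q F * ProductProcess.LambdaTilde μ s₀ u F))) := by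
  -- The constant `200 e ^ 66` is doubled because for `F = H` the two mixed terms coincide and are
  -- merged into one.
  refine ⟨1, one_pos, fun q hq => ⟨400 * Real.exp 33 ^ 2, by positivity, ?_⟩⟩
  intro Ω _ μ _ Ω' _ P _ N X hX hind u hu s₀
  have hu8 : 8 ≤ u := (le_max_left _ _).trans hu
  have hqu : q ≤ u ^ 2 := (Real.sqrt_le_left (by linarith)).1 ((le_max_right _ _).trans hu)
  have hC : ENNReal.ofReal (400 * Real.exp 33 ^ 2) = ENNReal.ofReal (200 * Real.exp 33 ^ 2) * 2 := by
    rw [← ENNReal.ofReal_ofNat 2, ← ENNReal.ofReal_mul (by positivity)]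
    congr 1
    ring
  rw [hC]
  refine ⟨fun F H hFm hHm hF hH => ?_, fun F hFm hF => ?_⟩
  · obtain ⟨E, hE, hP, hle⟩ :=
      ProductProcess.exists_event_prodDev_bound hX hind hq hqu hu8 s₀ hFm hHm hF hH
    refine ⟨E, hE, by rwa [one_mul], fun ω hω f hf h hh => (hle ω hω f hf h hh).trans ?_⟩
    gcongr
    exact le_mul_of_one_le_right zero_le one_le_two
  · obtain ⟨E, hE, hP, hle⟩ :=
      ProductProcess.exists_event_prodDev_bound hX hind hq hqu hu8 s₀ hFm hFm hF hF
    refine ⟨E, hE, by rwa [one_mul], fun ω hω f hf => ?_⟩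
    have h1 := hle ω hω f hf f hf
    simp only [ProductProcess.prodDev, ← pow_two] at h1
    refine h1.trans ?_
    rw [mul_assoc _ 2, mul_assoc (ENNReal.ofReal (u ^ 2)), ← pow_two, ← two_mul, mul_add 2,
      mul_left_comm _ 2]
    exact mul_le_mul' le_rfl (add_le_add (le_mul_of_one_le_left zero_le one_le_two) le_rfl)
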